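/- **Market.** In round $t=1,\dots,T$ a platform observes a feature $x_t\in\mathbb R^d$ and the realized supply curve $P=\alpha_0+\alpha_1Q+\epsilon_{St}$, then sets a service fee $a_t\ge 0$, and then observes the equilibrium quantity and price $$Q_t=\frac{f(x_t)+\epsilon_{Dt}-\alpha_0-\epsilon_{St}-a_t}{\alpha_1-\beta},\qquad P_t=\alpha_0+\epsilon_{St}+\alpha_1Q_t+a_t ,$$ that is, the point where the supply price plus the fee equals the (truthful) demand price $\beta Q+f(x_t)+\epsilon_{Dt}$. Here $\alpha_1\ge0>\beta$, the $x_t$ are i.i.d. with law $\nu$, $\epsilon_{St}\sim\mathcal N(0,\sigma_S^2)$ and $\epsilon_{Dt}\sim\mathcal N(0,\sigma_D^2)$ are i.i.d. over $t$, and the three sequences are independent. Quantities are not truncated at $0$. **Algorithms and regret.** A (possibly randomized) algorithm chooses $a_t$ as a measurable function of a random seed independent of the market, of the observations $(\alpha_0+\epsilon_{S\tau},x_\tau,P_\tau,Q_\tau)_{\tau<t}$, of $\alpha_0+\epsilon_{St}$ and of $x_t$. Let $r_t(a)=\mathbb E_{\epsilon_{Dt}}[a\,Q_t(a)]$ be the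 expected revenue of the fee $a$ given $x_t$ and $\epsilon_{St}$, where $Q_t(a)$ is the equilibrium quantity at the fee $a$, and let $a_t^*=\operatorname{argmax}_{a\ge0}r_t(a)$. The expected regret is $\mathrm{Regret}(T)=\sum_{t=1}^T\mathbb E[r_t(a_t^*)-r_t(a_t)]\in[0,\infty]$. **Theorem.** Let $\alpha_1\ge 0$, and let $[b_-,b_+]$ with $b_-<b_+$ and $b_+>\alpha_0$, $[\beta_-,\beta_+]\subset(-\infty,0)$ with $\beta_-<\beta_+$, and $[s_-,s_+]\subset(0,\infty)$ with $s_-<s_+$ be given. There is a constant $c>0$, depending only on $\alpha_0,\alpha_1$ and these three intervals, such that the following holds for all $T\ge1$, all $\sigma_S>0$, all $d$, every law $\nu$ on $\mathbb R^d$, every class $\mathcal F$ of functions $\mathbb R^d\to\mathbb R$ that contains the constant functions with values in $[b_-,b_+]$, and every algorithm (which may depend on all of the above): there are $f\in\mathcal F$, $\beta\in[\beta_-,\beta_+]$ and $\sigma_D\in[s_-,s_+]$ for which $$\mathrm{Regret}(T)\ \ge\ c\,\min\Big\{\sqrt T,\ \frac{\log T}{\sigma_S^2\,\big(1+\max\{0,\log(1/\sigma_S)\}\big)}\Big\}.$$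 -/

import Mathlib

open MeasureTheory ProbabilityTheory
open scoped NNReal ENNReal

noncomputable section

/-- A market with `d`-dimensional features: supply curve `P = α₀ + α₁ Q + ε_S`, demand curve
`P = β Q + f x + ε_D`, with independent noises `ε_S ∼ N(0, σS²)` and `ε_D ∼ N(0, σD²)`, and
features drawn from the law `ν`. -/
structure Market (d : ℕ) where
  α₀ : ℝ
  α₁ : ℝ
  β : ℝ
  f : (Fin d → ℝ) → ℝ
  ν : Measure (Fin d → ℝ)
  σS : ℝ
  σD : ℝ

/-- The law `N(0, σ²)`. -/
def centeredGaussian (σ : ℝ) : Measure ℝ := gaussianReal 0 (Real.toNNReal (σ ^ 2))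

instance (σ : ℝ) : IsProbabilityMeasure (centeredGaussian σ) := by
  unfold centeredGaussian; infer_instance

/-- What the platform has observed once a round is over: the intercept `s = α₀ + ε_S` of the
realized supply curve, the feature vector, and the equilibrium price and quantity. -/
structure Observation (d : ℕ) where
  supply : ℝ
  feature : Fin d → ℝ
  price : ℝ
  quantity : ℝ

/-- The measurable structure that makes an observation the tuple of its four entries. -/
instance (d : ℕ) : MeasurableSpace (Observation d) :=
  MeasurableSpace.comap
    (fun o : Observation d => (o.supply, o.feature, o.price, o.quantity)) inferInstance

/-- A (possibly randomized) pricing algorithm. In round `t = 0, 1, 2, …` it sets a nonnegative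
service fee on the basis of its internal random seed in `S`, the observations of the `t` rounds
completed so far, the realized supply intercept of the current round and the current feature. -/
structure PricingPolicy (S : Type*) [MeasurableSpace S] (d : ℕ) where
  fee : (t : ℕ) → S × (Fin t → Observation d) × ℝ × (Fin d → ℝ) → ℝ≥0
  measurable_fee : ∀ t, Measurable (fee t)

namespace Market

variable {d : ℕ} (M : Market d)

/-- Price asked by the sellers for the quantity `q`, if the supply intercept is `s`. -/
def supplyPrice (s q : ℝ) : ℝ := s + M.α₁ * q

/-- Price the buyer is willing to pay for the quantity `q` (truthful demand curve). -/
def demandPrice (x : Fin d → ℝ) (eD q : ℝ) : ℝ := M.β * q + M.f x + eD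

/-- Equilibrium quantity at the service fee `a`. -/
def quantity (x : Fin d → ℝ) (s eD a : ℝ) : ℝ := (M.f x + eD - s - a) / (M.α₁ - M.β)

/-- Equilibrium price at the service fee `a`. -/
def price (x : Fin d → ℝ) (s eD a : ℝ) : ℝ := M.supplyPrice s (M.quantity x s eD a) + a

/-- The equilibrium quantity is the only one at which supply price plus fee is the demand price. -/
theorem equilibrium_iff (h : M.β < M.α₁) (x : Fin d → ℝ) (s eD a q : ℝ) :
    M.supplyPrice s q + a = M.demandPrice x eD q ↔ q = M.quantity x s eD a := by
  have h' : M.α₁ - M.β ≠ 0 := by linarith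
  unfold supplyPrice demandPrice quantity
  rw [eq_div_iff h']
  constructor <;> intro H <;> linarith

/-- Expected revenue of the fee `a`, over the demand noise, given the feature `x` and the supply
intercept `s`. -/
def expectedRevenue (x : Fin d → ℝ) (s a : ℝ) : ℝ :=
  ∫ eD, a * M.quantity x s eD a ∂(centeredGaussian M.σD)

/-- The clairvoyant fee: the maximizer of the expected revenue over all fees `a ≥ 0`, see
`isMaxOn_optimalFee`. -/
def optimalFee (x : Fin d → ℝ) (s : ℝ) : ℝ := max 0 ((M.f x - s) / 2)

theorem expectedRevenue_eq (x : Fin d → ℝ) (s a : ℝ) :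
    M.expectedRevenue x s a = a * (M.f x - s - a) / (M.α₁ - M.β) := by
  have hi : Integrable (fun e : ℝ => e) (centeredGaussian M.σD) :=
    (memLp_id_gaussianReal 1).integrable le_rfl
  have h0 : ∫ e, e ∂(centeredGaussian M.σD) = 0 := integral_id_gaussianReal
  have hfun : (fun eD : ℝ => a * M.quantity x s eD a) =
      fun eD => a * (M.f x - s - a) / (M.α₁ - M.β) + a / (M.α₁ - M.β) * eD := by
    funext eD
    unfold quantity
    ring
  unfold expectedRevenue
  rw [hfun, integral_add (integrable_const _) (hi.const_mul _), integral_const_mul, h0]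
  simp

theorem isMaxOn_optimalFee (h : M.β < M.α₁) (x : Fin d → ℝ) (s : ℝ) :
    M.optimalFee x s ∈ Set.Ici 0 ∧
      IsMaxOn (M.expectedRevenue x s) (Set.Ici 0) (M.optimalFee x s) := by
  refine ⟨le_max_left 0 ((M.f x - s) / 2), fun a ha => ?_⟩
  have ha' : 0 ≤ a := ha
  have hpos : 0 < M.α₁ - M.β := by linarith
  change M.expectedRevenue x s a ≤ M.expectedRevenue x s (M.optimalFee x s)
  rw [expectedRevenue_eq, expectedRevenue_eq]
  apply div_le_div_of_nonneg_right _ hpos.le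
  unfold optimalFee
  rcases le_total 0 ((M.f x - s) / 2) with h2 | h2
  · rw [max_eq_right h2]
    nlinarith [sq_nonneg (a - (M.f x - s) / 2)]
  · rw [max_eq_left h2]
    nlinarith

/-- Expected loss of revenue in one round caused by the fee `a`, given `x` and `s`. -/
def revenueGap (x : Fin d → ℝ) (s a : ℝ) : ℝ :=
  M.expectedRevenue x s (M.optimalFee x s) - M.expectedRevenue x s a

/-- The expected loss of a nonnegative fee is nonnegative. -/
theorem revenueGap_nonneg (h : M.β < M.α₁) (x : Fin d → ℝ) (s a : ℝ) (ha : 0 ≤ a) :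
    0 ≤ M.revenueGap x s a :=
  sub_nonneg.2 ((M.isMaxOn_optimalFee h x s).2 ha)

/-- The law of the triple (feature, supply noise, demand noise) of one round. -/
def roundLaw : Measure ((Fin d → ℝ) × ℝ × ℝ) :=
  M.ν.prod ((centeredGaussian M.σS).prod (centeredGaussian M.σD))

variable {S : Type*} [MeasurableSpace S]

/-- The observations of the first `t` rounds, when the algorithm `π` runs with the random seed `u`
and `w i` is the triple (feature, supply noise, demand noise) of round `i`. -/
def history (π : PricingPolicy S d) (u : S) :
    (t : ℕ) → (Fin t → (Fin d → ℝ) × ℝ × ℝ) → (Fin t → Observation d)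
  | 0, _ => Fin.elim0
  | t + 1, w =>
    let past : Fin t → Observation d := history π u t (Fin.init w)
    let x : Fin d → ℝ := (w (Fin.last t)).1
    let s : ℝ := M.α₀ + (w (Fin.last t)).2.1
    let eD : ℝ := (w (Fin.last t)).2.2
    let a : ℝ := π.fee t (u, past, s, x)
    Fin.snoc (α := fun _ => Observation d) past ⟨s, x, M.price x s eD a, M.quantity x s eD a⟩

/-- Expected regret of round `t`: seed, completed rounds, current feature and current supply noise
are independent, and the expectation over the current demand noise is inside `revenueGap`. -/
def roundRegret (ρ : Measure S) (π : PricingPolicy S d) (t : ℕ) : ℝ≥0∞ :=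
  ∫⁻ u, ∫⁻ w, ∫⁻ x, ∫⁻ eS,
      ENNReal.ofReal (M.revenueGap x (M.α₀ + eS)
        (π.fee t (u, M.history π u t w, M.α₀ + eS, x)))
    ∂(centeredGaussian M.σS) ∂M.ν ∂(Measure.pi fun _ : Fin t => M.roundLaw) ∂ρ

/-- Expected regret over `T` rounds of the algorithm `π` with seed law `ρ`. -/
def regret (ρ : Measure S) (π : PricingPolicy S d) (T : ℕ) : ℝ≥0∞ :=
  ∑ t ∈ Finset.range T, M.roundRegret ρ π t

end Market

end

noncomputable section

/-! Consider the markets with `f = α₀ + m/τ`, `α₁ - β = κ/τ²` and `σD = s/τ²` (`hardMarket`), for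
`τ` in an interval `[1, 1 + D]`. If `e` is the supply noise, the observed quantity is Gaussian with
mean `(mτ - τ²(e + a))/κ` and a variance free of `τ`. The `τ`-derivative of the mean, `(m - 2τ(e +
a))/κ`, vanishes at `e = 0`, `a = m/(2τ)`, which is the optimal fee without supply noise. A round
therefore informs about `τ` only through a deviation from the optimal fee, which is paid for in
regret, and through `e`, which is worth `σS²` per round.

Quantitatively, the information in `t` rounds that separates `τ` from `τ + δ` is at most of order
`δ²(regret + σS² t + δ² t)` (`separation_hardMarket_le`). The optimal fees of the two markets differ
by order `δ`, so as long as the markets are not separated, round `t` costs order `δ²` in one of them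
(`le_seedRegret_hardMarket_add`). If every regret is at most `R ≤ √T`, then `δ² = η/(√T + σS² t)` is
still unresolved at round `t`. This distance shrinks with `t`, so no single pair of markets serves
all rounds; instead the regret is averaged over one fine grid of values of `τ`, in which each round
pairs points at its own distance (`mul_le_sum_roundRegret_hardMarket`). Summing over `t` gives `R`
at least of order `log(1 + σS²√T)/σS²`, which dominates the claimed minimum (`min_sqrt_log_le`).

Separation is measured by the Hellinger affinity, the integral of the square root of the likelihood
ratio. Its loss in one round is controlled by the separations under both laws of the history, so
adaptivity enters only through the two regrets (`SameNoise.lintegral_historyRootRatio_le_succ`). -/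

/-! ### Gaussian likelihood ratios -/

/-- The square root of the likelihood ratio between `N(μ', v)` and `N(μ, v)`. -/
def gaussianRootRatio (μ μ' : ℝ) (v : ℝ≥0) (q : ℝ) : ℝ≥0∞ :=
  ENNReal.ofReal (Real.exp ((μ' - μ) * (q - μ) / (2 * v) - (μ' - μ) ^ 2 / (4 * v)))

theorem measurable_gaussianRootRatio (v : ℝ≥0) {Ω : Type*} [MeasurableSpace Ω] {f g h : Ω → ℝ}
    (hf : Measurable f) (hg : Measurable g) (hh : Measurable h) :
    Measurable fun ω => gaussianRootRatio (f ω) (g ω) v (h ω) := by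
  unfold gaussianRootRatio
  exact ENNReal.measurable_ofReal.comp (Real.measurable_exp.comp (by fun_prop))

theorem gaussianRootRatio_ne_top (μ μ' : ℝ) (v : ℝ≥0) (q : ℝ) :
    gaussianRootRatio μ μ' v q ≠ ∞ := ENNReal.ofReal_ne_top

theorem lintegral_gaussianReal_eq_rootRatio_sq (μ μ' : ℝ) {v : ℝ≥0} (hv : v ≠ 0)
    {g : ℝ → ℝ≥0∞} (hg : Measurable g) :
    ∫⁻ q, g q ∂gaussianReal μ' v =
      ∫⁻ q, gaussianRootRatio μ μ' v q ^ 2 * g q ∂gaussianReal μ v := by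
  have hm : Measurable fun q => gaussianRootRatio μ μ' v q :=
    measurable_gaussianRootRatio v measurable_const measurable_const measurable_id
  rw [gaussianReal_of_var_ne_zero _ hv, gaussianReal_of_var_ne_zero _ hv,
    lintegral_withDensity_eq_lintegral_mul _ (measurable_gaussianPDF _ _) hg,
    lintegral_withDensity_eq_lintegral_mul _ (measurable_gaussianPDF _ _) (by fun_prop)]
  refine lintegral_congr fun q => ?_
  simp only [Pi.mul_apply]
  rw [← mul_assoc]
  congr 1
  have hv' : (v : ℝ) ≠ 0 := by exact_mod_cast hv
  rw [gaussianPDF, gaussianPDF, gaussianRootRatio, ← ENNReal.ofReal_pow (Real.exp_pos _).le,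
    ← ENNReal.ofReal_mul (gaussianPDFReal_nonneg _ _ _), gaussianPDFReal, gaussianPDFReal,
    ← Real.exp_nat_mul, mul_assoc _ (Real.exp _) (Real.exp _), ← Real.exp_add]
  congr 3
  push_cast
  field_simp
  ring

/-- The affinity equals `exp(-(μ' - μ)²/(8v))`, and `exp y ≥ 1 + y`. The weaker constant `4`
suffices. -/
theorem one_le_lintegral_gaussianRootRatio_add (μ μ' : ℝ) {v : ℝ≥0} (hv : v ≠ 0) :
    1 ≤ ∫⁻ q, gaussianRootRatio μ μ' v q ∂gaussianReal μ v
      + ENNReal.ofReal ((μ' - μ) ^ 2 / (4 * v)) := by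
  have hv' : (0 : ℝ) < v := by positivity
  set r : ℝ := (μ' - μ) / (2 * v) with hr
  have hfun : ∀ q, gaussianRootRatio μ μ' v q = ENNReal.ofReal
      (Real.exp (-(r * μ) - (μ' - μ) ^ 2 / (4 * v)) * Real.exp (r * q)) := by
    intro q
    rw [gaussianRootRatio, ← Real.exp_add, hr]
    congr 2
    ring
  have hi : Integrable (fun q => Real.exp (r * q)) (gaussianReal μ v) :=
    integrable_exp_mul_gaussianReal r
  have hmgf : ∫ q, Real.exp (r * q) ∂gaussianReal μ v = Real.exp (μ * r + v * r ^ 2 / 2) := by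
    have := congrFun (mgf_id_gaussianReal (μ := μ) (v := v)) r
    simpa [mgf] using this
  simp_rw [hfun]
  rw [← ofReal_integral_eq_lintegral_ofReal (hi.const_mul _)
    (Filter.Eventually.of_forall fun q => by positivity), integral_const_mul, hmgf,
    ← Real.exp_add, ← ENNReal.ofReal_add (by positivity) (by positivity), ← ENNReal.ofReal_one]
  apply ENNReal.ofReal_le_ofReal
  have h1 := Real.add_one_le_exp
    (-(r * μ) - (μ' - μ) ^ 2 / (4 * v) + (μ * r + v * r ^ 2 / 2))
  have h2 : (0 : ℝ) ≤ v * r ^ 2 / 2 := by positivity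
  linarith

theorem lintegral_sq_centeredGaussian (σ : ℝ) :
    ∫⁻ e, ENNReal.ofReal (e ^ 2) ∂centeredGaussian σ = ENNReal.ofReal (σ ^ 2) := by
  have h1 : MemLp (id : ℝ → ℝ) 2 (centeredGaussian σ) := memLp_id_gaussianReal 2
  have h0 : ∫ e, e ∂centeredGaussian σ = 0 := integral_id_gaussianReal
  have h := evariance_eq_lintegral_ofReal (X := id) (μ := centeredGaussian σ)
  rw [← ofReal_variance h1] at h
  simp only [id, h0, sub_zero] at h
  rw [← h]
  unfold centeredGaussian
  rw [variance_id_gaussianReal]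
  simp [sq_nonneg]

theorem half_le_centeredGaussian_Iic (σ : ℝ) : 2⁻¹ ≤ centeredGaussian σ (Set.Iic 0) := by
  have hmap : (centeredGaussian σ).map (fun x => -x) = centeredGaussian σ := by
    unfold centeredGaussian
    rw [gaussianReal_map_neg, neg_zero]
  have h1 : centeredGaussian σ (Set.Ici 0) = centeredGaussian σ (Set.Iic 0) := by
    conv_rhs => rw [← hmap]
    rw [Measure.map_apply measurable_neg measurableSet_Iic]
    congr 1
    ext x
    simp
  have h2 : 1 ≤ centeredGaussian σ (Set.Iic 0) + centeredGaussian σ (Set.Ici 0) := by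
    rw [← measure_univ (μ := centeredGaussian σ), ← Set.Iic_union_Ici (a := (0 : ℝ))]
    exact measure_union_le _ _
  rw [h1, ← mul_two] at h2
  rwa [ENNReal.inv_le_iff_le_mul (by simp) (by simp), mul_comm]

/-! ### Measurability of observations and histories -/

namespace Observation

variable {d : ℕ} {Ω : Type*} [MeasurableSpace Ω]

theorem measurable_mk {s p q : Ω → ℝ} {x : Ω → Fin d → ℝ} (hs : Measurable s)
    (hx : Measurable x) (hp : Measurable p) (hq : Measurable q) :
    Measurable fun ω => (⟨s ω, x ω, p ω, q ω⟩ : Observation d) :=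
  measurable_comap_iff.2 (hs.prodMk (hx.prodMk (hp.prodMk hq)))

theorem measurable_entries :
    Measurable fun o : Observation d => (o.supply, o.feature, o.price, o.quantity) :=
  comap_measurable _

theorem measurable_supply : Measurable (supply : Observation d → ℝ) :=
  measurable_entries.fst

theorem measurable_feature : Measurable (feature : Observation d → Fin d → ℝ) :=
  measurable_entries.snd.fst

theorem measurable_price : Measurable (price : Observation d → ℝ) :=
  measurable_entries.snd.snd.fst

theorem measurable_quantity : Measurable (quantity : Observation d → ℝ) :=
  measurable_entries.snd.snd.snd

end Observation

theorem Measurable.fin_snoc {Ω α : Type*} [MeasurableSpace Ω] [MeasurableSpace α] {t : ℕ}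
    {f : Ω → Fin t → α} {g : Ω → α} (hf : Measurable f) (hg : Measurable g) :
    Measurable fun ω => (Fin.snoc (α := fun _ => α) (f ω) (g ω) : Fin (t + 1) → α) := by
  refine measurable_pi_iff.2 fun i => ?_
  refine Fin.lastCases ?_ (fun j => ?_) i
  · simpa using hg
  · simpa [Function.comp_def] using (measurable_pi_apply j).comp hf

namespace Market

variable {d : ℕ} (M : Market d) {S : Type*} [MeasurableSpace S]

/-- The observation of a round with supply intercept `s`, feature `x`, fee `a` and equilibrium
quantity `q`. -/
def observe (s : ℝ) (x : Fin d → ℝ) (a q : ℝ) : Observation d := ⟨s, x, M.supplyPrice s q + a, q⟩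

/-- The mean of the equilibrium quantity. -/
def meanQuantity (s : ℝ) (x : Fin d → ℝ) (a : ℝ) : ℝ := (M.f x - s - a) / (M.α₁ - M.β)

/-- The variance of the equilibrium quantity. -/
def quantityVar : ℝ≥0 := Real.toNNReal ((M.σD / (M.α₁ - M.β)) ^ 2)

theorem measurable_observe {Ω : Type*} [MeasurableSpace Ω] {s a q : Ω → ℝ} {x : Ω → Fin d → ℝ}
    (hs : Measurable s) (hx : Measurable x) (ha : Measurable a) (hq : Measurable q) :
    Measurable fun ω => M.observe (s ω) (x ω) (a ω) (q ω) := by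
  unfold observe supplyPrice
  exact Observation.measurable_mk hs hx (by fun_prop) hq

theorem map_quantity (s : ℝ) (x : Fin d → ℝ) (a : ℝ) :
    (centeredGaussian M.σD).map (fun eD => M.quantity x s eD a) =
      gaussianReal (M.meanQuantity s x a) M.quantityVar := by
  have h1 := gaussianReal_map_const_mul (μ := 0) (v := Real.toNNReal (M.σD ^ 2))
    (M.α₁ - M.β)⁻¹
  have h2 := gaussianReal_map_const_add (μ := (M.α₁ - M.β)⁻¹ * 0)
    (v := .mk ((M.α₁ - M.β)⁻¹ ^ 2) (sq_nonneg _) * Real.toNNReal (M.σD ^ 2))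
    (M.meanQuantity s x a)
  rw [← h1, Measure.map_map (by fun_prop) (by fun_prop)] at h2
  have hv : NNReal.mk ((M.α₁ - M.β)⁻¹ ^ 2) (sq_nonneg _) * Real.toNNReal (M.σD ^ 2)
      = M.quantityVar := by
    apply NNReal.coe_injective
    simp only [quantityVar, NNReal.coe_mul, Real.coe_toNNReal _ (sq_nonneg _), NNReal.coe_mk]
    ring
  rw [hv, mul_zero, zero_add] at h2
  rw [← h2]
  unfold centeredGaussian
  congr 1
  funext e
  simp only [quantity, meanQuantity, Function.comp]
  ring

theorem history_succ (π : PricingPolicy S d) (u : S) (t : ℕ)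
    (w : Fin (t + 1) → (Fin d → ℝ) × ℝ × ℝ) :
    M.history π u (t + 1) w = Fin.snoc (α := fun _ => Observation d)
      (M.history π u t (Fin.init w))
      (M.observe (M.α₀ + (w (Fin.last t)).2.1) (w (Fin.last t)).1
        (π.fee t (u, M.history π u t (Fin.init w), M.α₀ + (w (Fin.last t)).2.1,
          (w (Fin.last t)).1))
        (M.quantity (w (Fin.last t)).1 (M.α₀ + (w (Fin.last t)).2.1) (w (Fin.last t)).2.2
          (π.fee t (u, M.history π u t (Fin.init w), M.α₀ + (w (Fin.last t)).2.1,
            (w (Fin.last t)).1)))) := rfl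

theorem measurable_quantity_comp (hf : Measurable M.f) {Ω : Type*} [MeasurableSpace Ω]
    {s a e : Ω → ℝ} {x : Ω → Fin d → ℝ}
    (hx : Measurable x) (hs : Measurable s) (he : Measurable e) (ha : Measurable a) :
    Measurable fun ω => M.quantity (x ω) (s ω) (e ω) (a ω) := by
  unfold quantity
  have := hf.comp hx
  simp only [Function.comp_def] at this
  fun_prop

theorem measurable_history (hf : Measurable M.f) (π : PricingPolicy S d) (t : ℕ) :
    Measurable fun p : S × (Fin t → (Fin d → ℝ) × ℝ × ℝ) => M.history π p.1 t p.2 := by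
  induction t with
  | zero => exact measurable_pi_iff.2 fun i => i.elim0
  | succ t ih =>
    have hi : Measurable fun p : S × (Fin (t + 1) → (Fin d → ℝ) × ℝ × ℝ) =>
        M.history π p.1 t (Fin.init p.2) := by
      refine ih.comp (measurable_fst.prodMk (measurable_pi_iff.2 fun i => ?_))
      exact (measurable_pi_apply _).comp measurable_snd
    have hl : Measurable fun p : S × (Fin (t + 1) → (Fin d → ℝ) × ℝ × ℝ) => p.2 (Fin.last t) :=
      (measurable_pi_apply _).comp measurable_snd
    have hs := hl.snd.fst.const_add M.α₀
    have ha : Measurable fun p : S × (Fin (t + 1) → (Fin d → ℝ) × ℝ × ℝ) =>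
        ((π.fee t (p.1, M.history π p.1 t (Fin.init p.2), M.α₀ + (p.2 (Fin.last t)).2.1,
          (p.2 (Fin.last t)).1) : ℝ≥0) : ℝ) :=
      ((π.measurable_fee t).comp
        (measurable_fst.prodMk (hi.prodMk (hs.prodMk hl.fst)))).coe_nnreal_real
    simp only [history_succ]
    exact hi.fin_snoc (M.measurable_observe hs hl.fst ha
      (M.measurable_quantity_comp hf hl.fst hs hl.snd.snd ha))

/-! ### The law of the history -/

variable {M} in
theorem measurable_history_apply (hf : Measurable M.f) (π : PricingPolicy S d) (u : S) (t : ℕ) :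
    Measurable (M.history π u t) :=
  (M.measurable_history hf π t).comp measurable_prodMk_left

/-- The law of the history of the first `t` rounds, when the random seed is `u`. -/
def historyLaw (π : PricingPolicy S d) (u : S) (t : ℕ) : Measure (Fin t → Observation d) :=
  (Measure.pi fun _ : Fin t => M.roundLaw).map (M.history π u t)

theorem lintegral_historyLaw (hf : Measurable M.f) (π : PricingPolicy S d) (u : S) (t : ℕ)
    {g : (Fin t → Observation d) → ℝ≥0∞} (hg : Measurable g) :
    ∫⁻ h, g h ∂M.historyLaw π u t =
      ∫⁻ w, g (M.history π u t w) ∂Measure.pi fun _ : Fin t => M.roundLaw :=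
  lintegral_map hg (measurable_history_apply hf π u t)

/-- The expectation of a function of feature, supply intercept and fee of round `t`, given the
seed `u` and the history `h`. -/
def roundExp (π : PricingPolicy S d) (u : S) (t : ℕ) (h : Fin t → Observation d)
    (g : (Fin d → ℝ) → ℝ → ℝ → ℝ≥0∞) : ℝ≥0∞ :=
  ∫⁻ x, ∫⁻ e, g x (M.α₀ + e) (π.fee t (u, h, M.α₀ + e, x)) ∂centeredGaussian M.σS ∂M.ν

variable [IsProbabilityMeasure M.ν]

instance : IsProbabilityMeasure M.roundLaw := by
  unfold roundLaw; infer_instance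

theorem isProbabilityMeasure_historyLaw (hf : Measurable M.f) (π : PricingPolicy S d) (u : S)
    (t : ℕ) : IsProbabilityMeasure (M.historyLaw π u t) :=
  Measure.isProbabilityMeasure_map (measurable_history_apply hf π u t).aemeasurable

theorem measurable_roundExp (π : PricingPolicy S d) (t : ℕ) {Ω : Type*} [MeasurableSpace Ω]
    {u : Ω → S} {h : Ω → Fin t → Observation d} (hu : Measurable u) (hh : Measurable h)
    {g : Ω → (Fin d → ℝ) → ℝ → ℝ → ℝ≥0∞}
    (hg : Measurable fun p : Ω × (Fin d → ℝ) × ℝ × ℝ => g p.1 p.2.1 p.2.2.1 p.2.2.2) :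
    Measurable fun ω => M.roundExp π (u ω) t (h ω) (g ω) := by
  unfold roundExp
  refine Measurable.lintegral_prod_right' (f := fun p : Ω × (Fin d → ℝ) =>
    ∫⁻ e, g p.1 p.2 (M.α₀ + e) (π.fee t (u p.1, h p.1, M.α₀ + e, p.2)) ∂centeredGaussian M.σS) ?_
  refine Measurable.lintegral_prod_right' (f := fun p : (Ω × (Fin d → ℝ)) × ℝ =>
    g p.1.1 p.1.2 (M.α₀ + p.2) (π.fee t (u p.1.1, h p.1.1, M.α₀ + p.2, p.1.2))) ?_
  have hs : Measurable fun p : (Ω × (Fin d → ℝ)) × ℝ => M.α₀ + p.2 := by fun_prop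
  have ha : Measurable fun p : (Ω × (Fin d → ℝ)) × ℝ =>
      ((π.fee t (u p.1.1, h p.1.1, M.α₀ + p.2, p.1.2) : ℝ≥0) : ℝ) :=
    ((π.measurable_fee t).comp ((hu.comp measurable_fst.fst).prodMk
      ((hh.comp measurable_fst.fst).prodMk (hs.prodMk measurable_fst.snd)))).coe_nnreal_real
  exact hg.comp (measurable_fst.fst.prodMk (measurable_fst.snd.prodMk (hs.prodMk ha)))

theorem lintegral_historyLaw_succ (hf : Measurable M.f) (π : PricingPolicy S d) (u : S) (t : ℕ)
    {g : (Fin (t + 1) → Observation d) → ℝ≥0∞} (hg : Measurable g) :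
    ∫⁻ h, g h ∂M.historyLaw π u (t + 1) =
      ∫⁻ h, M.roundExp π u t h (fun x s a => ∫⁻ q,
        g (Fin.snoc (α := fun _ => Observation d) h (M.observe s x a q))
        ∂gaussianReal (M.meanQuantity s x a) M.quantityVar) ∂M.historyLaw π u t := by
  have hobs : Measurable fun p : (((Fin t → Observation d) × (Fin d → ℝ)) × ℝ) × ℝ =>
      g (Fin.snoc (α := fun _ => Observation d) p.1.1.1
        (M.observe (M.α₀ + p.1.2) p.1.1.2 (π.fee t (u, p.1.1.1, M.α₀ + p.1.2, p.1.1.2))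
          (M.quantity p.1.1.2 (M.α₀ + p.1.2) p.2
            (π.fee t (u, p.1.1.1, M.α₀ + p.1.2, p.1.1.2))))) := by
    have hs : Measurable fun p : (((Fin t → Observation d) × (Fin d → ℝ)) × ℝ) × ℝ =>
      M.α₀ + p.1.2 := by fun_prop
    have ha : Measurable fun p : (((Fin t → Observation d) × (Fin d → ℝ)) × ℝ) × ℝ =>
        ((π.fee t (u, p.1.1.1, M.α₀ + p.1.2, p.1.1.2) : ℝ≥0) : ℝ) :=
      ((π.measurable_fee t).comp (measurable_const.prodMk (measurable_fst.fst.fst.prodMk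
        (hs.prodMk measurable_fst.fst.snd)))).coe_nnreal_real
    exact hg.comp (measurable_fst.fst.fst.fin_snoc (M.measurable_observe hs
      measurable_fst.fst.snd ha (M.measurable_quantity_comp hf measurable_fst.fst.snd hs
        measurable_snd ha)))
  have key : ∀ h, M.roundExp π u t h (fun x s a => ∫⁻ q,
        g (Fin.snoc (α := fun _ => Observation d) h (M.observe s x a q))
        ∂gaussianReal (M.meanQuantity s x a) M.quantityVar) =
      ∫⁻ x, ∫⁻ e, ∫⁻ e', g (Fin.snoc (α := fun _ => Observation d) h
        (M.observe (M.α₀ + e) x (π.fee t (u, h, M.α₀ + e, x))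
          (M.quantity x (M.α₀ + e) e' (π.fee t (u, h, M.α₀ + e, x)))))
        ∂centeredGaussian M.σD ∂centeredGaussian M.σS ∂M.ν := by
    intro h
    unfold roundExp
    refine lintegral_congr fun x => lintegral_congr fun e => ?_
    beta_reduce
    rw [← map_quantity, lintegral_map]
    · exact hg.comp (measurable_const.fin_snoc (M.measurable_observe measurable_const
        measurable_const measurable_const measurable_id))
    · unfold quantity
      fun_prop
  simp_rw [key]
  rw [M.lintegral_historyLaw hf π u (t + 1) hg, M.lintegral_historyLaw hf π u t]
  swap
  · exact Measurable.lintegral_prod_right' (Measurable.lintegral_prod_right'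
      (Measurable.lintegral_prod_right' hobs))
  -- The last round is split off from the product measure; the history of the earlier rounds depends
  -- only on the remaining factor.
  have hmp := measurePreserving_piFinSuccAbove (fun _ : Fin (t + 1) => M.roundLaw) (Fin.last t)
  have hG : Measurable fun p : ((Fin d → ℝ) × ℝ × ℝ) × (Fin t → (Fin d → ℝ) × ℝ × ℝ) =>
      g (Fin.snoc (α := fun _ => Observation d) (M.history π u t p.2)
        (M.observe (M.α₀ + p.1.2.1) p.1.1
          (π.fee t (u, M.history π u t p.2, M.α₀ + p.1.2.1, p.1.1))
          (M.quantity p.1.1 (M.α₀ + p.1.2.1) p.1.2.2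
            (π.fee t (u, M.history π u t p.2, M.α₀ + p.1.2.1, p.1.1))))) :=
    hobs.comp (((((measurable_history_apply hf π u t).comp measurable_snd).prodMk
      measurable_fst.fst).prodMk measurable_fst.snd.fst).prodMk measurable_fst.snd.snd)
  have h1 := hmp.lintegral_comp hG
  have h2 : ∀ w : Fin (t + 1) → (Fin d → ℝ) × ℝ × ℝ,
      MeasurableEquiv.piFinSuccAbove (fun _ => (Fin d → ℝ) × ℝ × ℝ) (Fin.last t) w
        = (w (Fin.last t), Fin.init w) := by
    intro w
    simp [MeasurableEquiv.piFinSuccAbove, Fin.insertNthEquiv]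
  simp only [h2] at h1
  simp only [history_succ]
  rw [h1, lintegral_prod_symm' _ hG]
  refine lintegral_congr fun w => ?_
  have hG' := hG.comp (measurable_prodMk_right (y := w))
  simp only [Function.comp_def] at hG'
  unfold roundLaw
  rw [lintegral_prod _ hG'.aemeasurable]
  refine lintegral_congr fun x => ?_
  exact lintegral_prod _ (hG'.comp measurable_prodMk_left).aemeasurable

end Market

/-! ### Change of measure between two markets and Hellinger affinity -/

theorem ENNReal.le_half_one_add_sq (x : ℝ≥0∞) : x ≤ 2⁻¹ * (1 + x ^ 2) := by
  rcases eq_or_ne x ∞ with rfl | hx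
  · simp
  lift x to ℝ≥0 using hx
  have h : (2⁻¹ : ℝ≥0∞) = ((2⁻¹ : ℝ≥0) : ℝ≥0∞) := by simp
  rw [h]
  norm_cast
  rw [← NNReal.coe_le_coe]
  push_cast
  nlinarith [sq_nonneg ((x : ℝ) - 1)]

namespace Market

variable {d : ℕ} (M M' : Market d) {S : Type*} [MeasurableSpace S]

theorem roundExp_mono (π : PricingPolicy S d) (u : S) (t : ℕ) (h : Fin t → Observation d)
    {g g' : (Fin d → ℝ) → ℝ → ℝ → ℝ≥0∞} (hg : ∀ x s a, 0 ≤ a → g x s a ≤ g' x s a) :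
    M.roundExp π u t h g ≤ M.roundExp π u t h g' :=
  lintegral_mono fun _ => lintegral_mono fun _ => hg _ _ _ (NNReal.coe_nonneg _)

theorem roundExp_const_mul (π : PricingPolicy S d) (u : S) (t : ℕ) (h : Fin t → Observation d)
    (g : (Fin d → ℝ) → ℝ → ℝ → ℝ≥0∞) {c : ℝ≥0∞} (hc : c ≠ ∞) :
    M.roundExp π u t h (fun x s a => c * g x s a) = c * M.roundExp π u t h g := by
  unfold roundExp
  rw [← lintegral_const_mul' _ _ hc]
  exact lintegral_congr fun x => lintegral_const_mul' _ _ hc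

theorem roundExp_const [IsProbabilityMeasure M.ν] (π : PricingPolicy S d) (u : S) (t : ℕ)
    (h : Fin t → Observation d) (c : ℝ≥0∞) : M.roundExp π u t h (fun _ _ _ => c) = c := by
  simp [roundExp]

theorem roundExp_add_left [IsProbabilityMeasure M.ν] (π : PricingPolicy S d) (u : S) (t : ℕ)
    (h : Fin t → Observation d)
    {g g' : (Fin d → ℝ) → ℝ → ℝ → ℝ≥0∞}
    (hg : Measurable fun p : (Fin d → ℝ) × ℝ × ℝ => g p.1 p.2.1 p.2.2) :
    M.roundExp π u t h (fun x s a => g x s a + g' x s a) =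
      M.roundExp π u t h g + M.roundExp π u t h g' := by
  unfold roundExp
  have hm : Measurable fun p : (Fin d → ℝ) × ℝ =>
      g p.1 (M.α₀ + p.2) (π.fee t (u, h, M.α₀ + p.2, p.1)) := by
    have hs : Measurable fun p : (Fin d → ℝ) × ℝ => M.α₀ + p.2 := by fun_prop
    have ha : Measurable fun p : (Fin d → ℝ) × ℝ =>
        ((π.fee t (u, h, M.α₀ + p.2, p.1) : ℝ≥0) : ℝ) :=
      ((π.measurable_fee t).comp (measurable_const.prodMk (measurable_const.prodMk
        (hs.prodMk measurable_fst)))).coe_nnreal_real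
    exact hg.comp (measurable_fst.prodMk (hs.prodMk ha))
  rw [← lintegral_add_left hm.lintegral_prod_right']
  exact lintegral_congr fun x => lintegral_add_left (hm.comp measurable_prodMk_left) _

theorem measurable_meanQuantity (hf : Measurable M.f) {Ω : Type*} [MeasurableSpace Ω]
    {s a : Ω → ℝ} {x : Ω → Fin d → ℝ}
    (hs : Measurable s) (hx : Measurable x) (ha : Measurable a) :
    Measurable fun ω => M.meanQuantity (s ω) (x ω) (a ω) := by
  unfold meanQuantity
  have := hf.comp hx
  simp only [Function.comp_def] at this
  fun_prop

/-- Writing the Gaussian as the image of the fixed demand noise moves the dependence on `ω` into the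
integrand, so the measurability of a Gaussian in its mean is not needed. -/
theorem measurable_lintegral_quantity (hf : Measurable M.f) {Ω : Type*} [MeasurableSpace Ω]
    {s a : Ω → ℝ} {x : Ω → Fin d → ℝ}
    (hs : Measurable s) (hx : Measurable x) (ha : Measurable a) {g : Ω → ℝ → ℝ≥0∞}
    (hg : Measurable (Function.uncurry g)) :
    Measurable fun ω => ∫⁻ q, g ω q
      ∂gaussianReal (M.meanQuantity (s ω) (x ω) (a ω)) M.quantityVar := by
  have h1 : ∀ ω, ∫⁻ q, g ω q ∂gaussianReal (M.meanQuantity (s ω) (x ω) (a ω)) M.quantityVar =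
      ∫⁻ e, g ω (M.quantity (x ω) (s ω) e (a ω)) ∂centeredGaussian M.σD := by
    intro ω
    have hg' : Measurable (g ω) := hg.comp (measurable_prodMk_left (x := ω))
    rw [← map_quantity, lintegral_map hg']
    unfold quantity
    fun_prop
  simp_rw [h1]
  refine Measurable.lintegral_prod_right' (f := fun p : Ω × ℝ =>
    g p.1 (M.quantity (x p.1) (s p.1) p.2 (a p.1))) ?_
  exact hg.comp (measurable_fst.prodMk (M.measurable_quantity_comp hf (hx.comp measurable_fst)
    (hs.comp measurable_fst) measurable_snd (ha.comp measurable_fst)))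

/-- Two markets with the same supply side and the same nondegenerate noise in the equilibrium
quantity. -/
structure SameNoise : Prop where
  α₀_eq : M'.α₀ = M.α₀
  α₁_eq : M'.α₁ = M.α₁
  ν_eq : M'.ν = M.ν
  σS_eq : M'.σS = M.σS
  var_eq : M'.quantityVar = M.quantityVar
  var_ne_zero : M.quantityVar ≠ 0
  measurable_f : Measurable M.f
  measurable_f' : Measurable M'.f

/-- The square root of the likelihood ratio of one observation between the markets `M'` and
`M`. -/
def rootRatio (o : Observation d) : ℝ≥0∞ :=
  -- The fee is not an entry of the observation; it is recovered as the price minus the supply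
  -- price, so the ratio does not involve the policy.
  gaussianRootRatio
    (M.meanQuantity o.supply o.feature (o.price - M.supplyPrice o.supply o.quantity))
    (M'.meanQuantity o.supply o.feature (o.price - M.supplyPrice o.supply o.quantity))
    M.quantityVar o.quantity

/-- The square root of the likelihood ratio of a history between the markets `M'` and `M`. -/
def historyRootRatio {t : ℕ} (h : Fin t → Observation d) : ℝ≥0∞ := ∏ i, M.rootRatio M' (h i)

/-- A quarter of the squared standardized difference of the mean quantities in `M'` and `M`. -/
def separation (x : Fin d → ℝ) (s a : ℝ) : ℝ≥0∞ :=
  ENNReal.ofReal ((M'.meanQuantity s x a - M.meanQuantity s x a) ^ 2 / (4 * M.quantityVar))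

theorem rootRatio_observe (s : ℝ) (x : Fin d → ℝ) (a q : ℝ) :
    M.rootRatio M' (M.observe s x a q) =
      gaussianRootRatio (M.meanQuantity s x a) (M'.meanQuantity s x a) M.quantityVar q := by
  simp [rootRatio, observe]

theorem historyRootRatio_snoc {t : ℕ} (h : Fin t → Observation d) (o : Observation d) :
    M.historyRootRatio M' (Fin.snoc (α := fun _ => Observation d) h o) =
      M.historyRootRatio M' h * M.rootRatio M' o := by
  simp [historyRootRatio, Fin.prod_univ_castSucc]

theorem historyRootRatio_ne_top {t : ℕ} (h : Fin t → Observation d) :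
    M.historyRootRatio M' h ≠ ∞ :=
  ENNReal.prod_ne_top fun _ _ => gaussianRootRatio_ne_top _ _ _ _

variable {M M'}

theorem SameNoise.measurable_rootRatio (H : SameNoise M M') : Measurable (M.rootRatio M') := by
  have ha : Measurable fun o : Observation d =>
      o.price - M.supplyPrice o.supply o.quantity := by
    unfold supplyPrice
    exact Observation.measurable_price.sub
      (Observation.measurable_supply.add (Observation.measurable_quantity.const_mul _))
  exact measurable_gaussianRootRatio _
    (M.measurable_meanQuantity H.measurable_f Observation.measurable_supply
      Observation.measurable_feature ha)
    (M'.measurable_meanQuantity H.measurable_f' Observation.measurable_supply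
      Observation.measurable_feature ha) Observation.measurable_quantity

theorem SameNoise.measurable_historyRootRatio (H : SameNoise M M') (t : ℕ) :
    Measurable (M.historyRootRatio M' : (Fin t → Observation d) → ℝ≥0∞) :=
  Finset.measurable_fun_prod _ fun i _ => H.measurable_rootRatio.comp (measurable_pi_apply i)

theorem SameNoise.roundExp_eq (H : SameNoise M M') (π : PricingPolicy S d) (u : S) (t : ℕ)
    (h : Fin t → Observation d) (g : (Fin d → ℝ) → ℝ → ℝ → ℝ≥0∞) :
    M'.roundExp π u t h g = M.roundExp π u t h g := by
  unfold roundExp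
  rw [H.α₀_eq, H.ν_eq, H.σS_eq]

theorem SameNoise.measurable_separation (H : SameNoise M M') :
    Measurable fun p : (Fin d → ℝ) × ℝ × ℝ => M.separation M' p.1 p.2.1 p.2.2 := by
  have h1 := M.measurable_meanQuantity H.measurable_f (Ω := (Fin d → ℝ) × ℝ × ℝ)
    measurable_snd.fst measurable_fst measurable_snd.snd
  have h2 := M'.measurable_meanQuantity H.measurable_f' (Ω := (Fin d → ℝ) × ℝ × ℝ)
    measurable_snd.fst measurable_fst measurable_snd.snd
  exact ENNReal.measurable_ofReal.comp (((h2.sub h1).pow_const 2).div_const _)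

theorem SameNoise.separation_comm (H : SameNoise M M') (x : Fin d → ℝ) (s a : ℝ) :
    M'.separation M x s a = M.separation M' x s a := by
  unfold separation
  rw [H.var_eq, ← neg_sub, neg_sq]

variable [IsProbabilityMeasure M.ν] [IsProbabilityMeasure M'.ν]

/-- Change of measure between the laws of the history in two markets. -/
theorem SameNoise.lintegral_historyLaw_eq (H : SameNoise M M') (π : PricingPolicy S d) (u : S)
    (t : ℕ) {g : (Fin t → Observation d) → ℝ≥0∞} (hg : Measurable g) :
    ∫⁻ h, g h ∂M'.historyLaw π u t =
      ∫⁻ h, M.historyRootRatio M' h ^ 2 * g h ∂M.historyLaw π u t := by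
  induction t with
  | zero =>
    have := M.isProbabilityMeasure_historyLaw H.measurable_f π u 0
    have := M'.isProbabilityMeasure_historyLaw H.measurable_f' π u 0
    have hs : ∀ h : Fin 0 → Observation d, h = Fin.elim0 := fun h => Subsingleton.elim _ _
    have h1 : ∀ h : Fin 0 → Observation d, g h = g Fin.elim0 := fun h => by rw [hs h]
    have h2 : ∀ h : Fin 0 → Observation d, M.historyRootRatio M' h = 1 := fun h => by
      simp [historyRootRatio]
    simp_rw [h2, h1]
    simp
  | succ t ih =>
    have hK := H.measurable_historyRootRatio (t + 1)
    have hsn : Measurable fun p : ((Fin t → Observation d) × (Fin d → ℝ) × ℝ × ℝ) × ℝ =>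
        (Fin.snoc (α := fun _ => Observation d) p.1.1
          (M.observe p.1.2.2.1 p.1.2.1 p.1.2.2.2 p.2) : Fin (t + 1) → Observation d) :=
      measurable_fst.fst.fin_snoc (M.measurable_observe measurable_fst.snd.snd.fst
        measurable_fst.snd.fst measurable_fst.snd.snd.snd measurable_snd)
    have hobs : M'.observe = M.observe := by
      funext s x a q
      simp [observe, supplyPrice, H.α₁_eq]
    rw [M'.lintegral_historyLaw_succ H.measurable_f' π u t hg, ih,
      M.lintegral_historyLaw_succ H.measurable_f π u t (by fun_prop)]
    · refine lintegral_congr fun h => ?_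
      rw [H.roundExp_eq, ← roundExp_const_mul _ _ _ _ _ _
        (ENNReal.pow_ne_top (M.historyRootRatio_ne_top M' h))]
      congr 1
      funext x s a
      have hg' : Measurable fun q => g (Fin.snoc (α := fun _ => Observation d) h
          (M.observe s x a q)) :=
        hg.comp (hsn.comp (measurable_prodMk_left (x := (h, x, s, a))))
      rw [hobs, H.var_eq, lintegral_gaussianReal_eq_rootRatio_sq (M.meanQuantity s x a) _
        H.var_ne_zero hg',
        ← lintegral_const_mul' _ _ (ENNReal.pow_ne_top (M.historyRootRatio_ne_top M' h))]
      refine lintegral_congr fun q => ?_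
      rw [historyRootRatio_snoc, rootRatio_observe, mul_pow, mul_assoc]
    · refine M'.measurable_roundExp π t measurable_const measurable_id ?_
      rw [hobs]
      exact M'.measurable_lintegral_quantity H.measurable_f' (Ω := _ × _)
        measurable_snd.snd.fst measurable_snd.fst measurable_snd.snd.snd
        (g := fun p q => g (Fin.snoc (α := fun _ => Observation d) p.1
          (M.observe p.2.2.1 p.2.1 p.2.2.2 q))) (hg.comp hsn)

theorem SameNoise.lintegral_historyRootRatio_sq (H : SameNoise M M') (π : PricingPolicy S d)
    (u : S) (t : ℕ) : ∫⁻ h, M.historyRootRatio M' h ^ 2 ∂M.historyLaw π u t = 1 := by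
  have := M'.isProbabilityMeasure_historyLaw H.measurable_f' π u t
  have := H.lintegral_historyLaw_eq π u t (g := fun _ => 1) measurable_const
  simpa using this.symm

/-- The Hellinger affinity of the laws of the history decreases slowly. -/
theorem SameNoise.lintegral_historyRootRatio_le_succ (H : SameNoise M M')
    (π : PricingPolicy S d) (u : S) (t : ℕ) :
    ∫⁻ h, M.historyRootRatio M' h ∂M.historyLaw π u t ≤
      ∫⁻ h, M.historyRootRatio M' h ∂M.historyLaw π u (t + 1) +
        2⁻¹ * (∫⁻ h, M.roundExp π u t h (M.separation M') ∂M.historyLaw π u t +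
          ∫⁻ h, M'.roundExp π u t h (M'.separation M) ∂M'.historyLaw π u t) := by
  have hJ : Measurable fun h => M.roundExp π u t h (M.separation M') :=
    M.measurable_roundExp π t measurable_const measurable_id
      (H.measurable_separation.comp measurable_snd)
  have hK := H.measurable_historyRootRatio t
  have hJ' : ∀ h, M'.roundExp π u t h (M'.separation M) =
      M.roundExp π u t h (M.separation M') := by
    intro h
    rw [H.roundExp_eq]
    congr 1
    funext x s a
    exact H.separation_comm x s a
  simp_rw [hJ']
  rw [H.lintegral_historyLaw_eq π u t hJ, ← lintegral_add_left hJ,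
    ← lintegral_const_mul' _ _ (by simp),
    M.lintegral_historyLaw_succ H.measurable_f π u t (H.measurable_historyRootRatio (t + 1)),
    ← lintegral_add_right _ (by fun_prop)]
  refine lintegral_mono fun h => ?_
  simp_rw [historyRootRatio_snoc, rootRatio_observe]
  set K := M.historyRootRatio M' h with hKdef
  have hKtop : K ≠ ∞ := M.historyRootRatio_ne_top M' h
  simp_rw [lintegral_const_mul' _ _ hKtop]
  rw [roundExp_const_mul _ _ _ _ _ _ hKtop]
  set J := M.roundExp π u t h (M.separation M') with hJdef
  have h1 : 1 ≤ M.roundExp π u t h (fun x s a => ∫⁻ q,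
      gaussianRootRatio (M.meanQuantity s x a) (M'.meanQuantity s x a) M.quantityVar q
      ∂gaussianReal (M.meanQuantity s x a) M.quantityVar) + J := by
    rw [hJdef, add_comm, ← M.roundExp_add_left π u t h H.measurable_separation]
    conv_lhs => rw [← M.roundExp_const π u t h 1]
    refine M.roundExp_mono π u t h fun x s a _ => ?_
    rw [add_comm]
    exact one_le_lintegral_gaussianRootRatio_add _ _ H.var_ne_zero
  calc K = K * 1 := (mul_one K).symm
    _ ≤ K * (M.roundExp π u t h (fun x s a => ∫⁻ q,
      gaussianRootRatio (M.meanQuantity s x a) (M'.meanQuantity s x a) M.quantityVar q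
      ∂gaussianReal (M.meanQuantity s x a) M.quantityVar) + J) := by gcongr
    _ ≤ _ := by
      rw [mul_add]
      refine add_le_add le_rfl ?_
      -- As `K²` is the density of the law of the history in `M'`, bounding `K` by `(1 + K²)/2`
      -- shares the loss of affinity equally between the two markets.
      calc K * J ≤ (2⁻¹ * (1 + K ^ 2)) * J := by gcongr; exact ENNReal.le_half_one_add_sq K
        _ = 2⁻¹ * (J + K ^ 2 * J) := by ring

theorem SameNoise.one_le_lintegral_historyRootRatio_add (H : SameNoise M M')
    (π : PricingPolicy S d) (u : S) (t : ℕ) :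
    1 ≤ ∫⁻ h, M.historyRootRatio M' h ∂M.historyLaw π u t +
        2⁻¹ * ∑ i ∈ Finset.range t,
          (∫⁻ h, M.roundExp π u i h (M.separation M') ∂M.historyLaw π u i +
            ∫⁻ h, M'.roundExp π u i h (M'.separation M) ∂M'.historyLaw π u i) := by
  induction t with
  | zero =>
    have := M.isProbabilityMeasure_historyLaw H.measurable_f π u 0
    simp [historyRootRatio]
  | succ t ih =>
    rw [Finset.sum_range_succ, mul_add, add_comm (2⁻¹ * _), ← add_assoc]
    refine ih.trans ?_
    gcongr
    exact H.lintegral_historyRootRatio_le_succ π u t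

end Market

/-! ### Regret as an integral over the seed and the law of the history -/

namespace Market

variable {d : ℕ} (M M' : Market d) {S : Type*} [MeasurableSpace S]

/-- Revenue is a concave parabola in the fee, so equality holds when the optimum is interior. When
the optimum is clipped to `0`, the parabola already decreases there and the gap is only larger. -/
theorem sq_sub_optimalFee_le_revenueGap (h : M.β < M.α₁) (x : Fin d → ℝ) (s : ℝ) {a : ℝ}
    (ha : 0 ≤ a) : (a - M.optimalFee x s) ^ 2 / (M.α₁ - M.β) ≤ M.revenueGap x s a := by
  have hpos : 0 < M.α₁ - M.β := by linarith
  unfold revenueGap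
  rw [expectedRevenue_eq, expectedRevenue_eq, ← sub_div]
  apply div_le_div_of_nonneg_right _ hpos.le
  unfold optimalFee
  rcases le_total 0 ((M.f x - s) / 2) with h2 | h2
  · rw [max_eq_right h2]
    nlinarith
  · rw [max_eq_left h2]
    nlinarith

theorem measurable_revenueGap (hf : Measurable M.f) :
    Measurable fun p : (Fin d → ℝ) × ℝ × ℝ => M.revenueGap p.1 p.2.1 p.2.2 := by
  have h : Measurable fun p : (Fin d → ℝ) × ℝ × ℝ => M.f p.1 := hf.comp measurable_fst
  simp only [revenueGap, expectedRevenue_eq, optimalFee]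
  fun_prop

/-- The expected regret of round `t`, given the seed `u`. -/
def seedRegret (π : PricingPolicy S d) (u : S) (t : ℕ) : ℝ≥0∞ :=
  ∫⁻ h, M.roundExp π u t h (fun x s a => ENNReal.ofReal (M.revenueGap x s a))
    ∂M.historyLaw π u t

theorem measurable_roundExp_revenueGap [IsProbabilityMeasure M.ν] (hf : Measurable M.f)
    (π : PricingPolicy S d) (t : ℕ) {Ω : Type*} [MeasurableSpace Ω]
    {u : Ω → S} {h : Ω → Fin t → Observation d} (hu : Measurable u) (hh : Measurable h) :
    Measurable fun ω => M.roundExp π (u ω) t (h ω)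
      (fun x s a => ENNReal.ofReal (M.revenueGap x s a)) :=
  M.measurable_roundExp π t hu hh
    (ENNReal.measurable_ofReal.comp ((M.measurable_revenueGap hf).comp measurable_snd))

theorem seedRegret_eq [IsProbabilityMeasure M.ν] (hf : Measurable M.f)
    (π : PricingPolicy S d) (u : S) (t : ℕ) :
    M.seedRegret π u t = ∫⁻ w, M.roundExp π u t (M.history π u t w)
      (fun x s a => ENNReal.ofReal (M.revenueGap x s a)) ∂Measure.pi fun _ : Fin t => M.roundLaw :=
  M.lintegral_historyLaw hf π u t
    (M.measurable_roundExp_revenueGap hf π t measurable_const measurable_id)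

theorem measurable_seedRegret [IsProbabilityMeasure M.ν] (hf : Measurable M.f)
    (π : PricingPolicy S d) (t : ℕ) : Measurable fun u => M.seedRegret π u t := by
  simp_rw [M.seedRegret_eq hf]
  exact Measurable.lintegral_prod_right' (M.measurable_roundExp_revenueGap hf π t measurable_fst
    (M.measurable_history hf π t))

theorem roundRegret_eq_lintegral_seedRegret [IsProbabilityMeasure M.ν] (hf : Measurable M.f)
    (ρ : Measure S) (π : PricingPolicy S d) (t : ℕ) :
    M.roundRegret ρ π t = ∫⁻ u, M.seedRegret π u t ∂ρ := by
  simp_rw [M.seedRegret_eq hf]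
  rfl

/-- Restricts to nonpositive supply noise, an event of probability at least one half. On it the
optimal fees of the hard markets are not clipped at `0`. -/
theorem half_mul_le_roundExp [IsProbabilityMeasure M.ν] (π : PricingPolicy S d) (u : S) (t : ℕ)
    (h : Fin t → Observation d) {g : (Fin d → ℝ) → ℝ → ℝ → ℝ≥0∞} {c : ℝ≥0∞}
    (hg : ∀ x s a, 0 ≤ a → s ≤ M.α₀ → c ≤ g x s a) : 2⁻¹ * c ≤ M.roundExp π u t h g := by
  have h1 : ∀ x, 2⁻¹ * c ≤ ∫⁻ e, g x (M.α₀ + e) (π.fee t (u, h, M.α₀ + e, x))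
      ∂centeredGaussian M.σS := by
    intro x
    calc 2⁻¹ * c ≤ centeredGaussian M.σS (Set.Iic 0) * c := by
          gcongr
          exact half_le_centeredGaussian_Iic _
      _ = ∫⁻ _ in Set.Iic 0, c ∂centeredGaussian M.σS := by
          rw [setLIntegral_const, mul_comm]
      _ ≤ ∫⁻ e in Set.Iic 0, g x (M.α₀ + e) (π.fee t (u, h, M.α₀ + e, x))
            ∂centeredGaussian M.σS :=
          setLIntegral_mono' measurableSet_Iic fun e he =>
            hg _ _ _ (NNReal.coe_nonneg _) (by simpa using he)
      _ ≤ _ := setLIntegral_le_lintegral _ _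
  calc 2⁻¹ * c = ∫⁻ _, 2⁻¹ * c ∂M.ν := by simp
    _ ≤ _ := lintegral_mono h1

theorem roundExp_sq_supply [IsProbabilityMeasure M.ν] (π : PricingPolicy S d) (u : S) (t : ℕ)
    (h : Fin t → Observation d) :
    M.roundExp π u t h (fun _ s _ => ENNReal.ofReal ((s - M.α₀) ^ 2)) =
      ENNReal.ofReal (M.σS ^ 2) := by
  simp [roundExp, lintegral_sq_centeredGaussian]

/-! ### A one-parameter family of markets that are hard to tell apart -/

/-- Along this family, the fee that is optimal for a vanishing supply noise carries no first-order
information about the parameter `τ`. -/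
def hardMarket (α₀ α₁ κ m s : ℝ) (ν : Measure (Fin d → ℝ)) (σS τ : ℝ) : Market d where
  α₀ := α₀
  α₁ := α₁
  β := α₁ - κ / τ ^ 2
  f := fun _ => α₀ + m / τ
  ν := ν
  σS := σS
  σD := s / τ ^ 2

section hardMarket

variable {α₀ α₁ κ m s σS τ τ' : ℝ} {ν : Measure (Fin d → ℝ)}

theorem hardMarket_quantityVar (hτ : 1 ≤ τ) :
    (hardMarket α₀ α₁ κ m s ν σS τ).quantityVar = Real.toNNReal ((s / κ) ^ 2) := by
  have : τ ≠ 0 := by positivity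
  simp only [quantityVar, hardMarket, sub_sub_cancel]
  congr 2
  field_simp

theorem hardMarket_meanQuantity (hτ : 1 ≤ τ) (z : ℝ) (x : Fin d → ℝ) (a : ℝ) :
    (hardMarket α₀ α₁ κ m s ν σS τ).meanQuantity z x a =
      (m * τ - τ ^ 2 * (z - α₀ + a)) / κ := by
  have : τ ≠ 0 := by positivity
  simp only [meanQuantity, hardMarket, sub_sub_cancel]
  rw [div_div_eq_mul_div]
  congr 1
  field_simp
  ring

theorem hardMarket_sameNoise (hκ : 0 < κ) (hs : 0 < s) (hτ : 1 ≤ τ) (hτ' : 1 ≤ τ') :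
    SameNoise (hardMarket α₀ α₁ κ m s ν σS τ) (hardMarket α₀ α₁ κ m s ν σS τ') where
  α₀_eq := rfl
  α₁_eq := rfl
  ν_eq := rfl
  σS_eq := rfl
  var_eq := by rw [hardMarket_quantityVar hτ, hardMarket_quantityVar hτ']
  var_ne_zero := by
    rw [hardMarket_quantityVar hτ, ne_eq, Real.toNNReal_eq_zero, not_le]
    positivity
  measurable_f := measurable_const
  measurable_f' := measurable_const

theorem sq_sub_optimalFee_le_mul_revenueGap_hardMarket (hκ : 0 < κ) (hτ : 1 ≤ τ)
    (x : Fin d → ℝ) (z : ℝ) {a : ℝ} (ha : 0 ≤ a) :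
    (a - max 0 ((α₀ + m / τ - z) / 2)) ^ 2 ≤
      κ * (hardMarket α₀ α₁ κ m s ν σS τ).revenueGap x z a := by
  have hτ0 : 0 < τ := by linarith
  have h := (hardMarket α₀ α₁ κ m s ν σS τ).sq_sub_optimalFee_le_revenueGap
    (by simp only [hardMarket]; linarith [show 0 < κ / τ ^ 2 by positivity]) x z ha
  simp only [hardMarket, optimalFee, sub_sub_cancel] at h ⊢
  rw [div_le_iff₀ (by positivity)] at h
  refine h.trans ?_
  rw [mul_comm]
  refine mul_le_mul_of_nonneg_right (div_le_self hκ.le (one_le_pow₀ hτ)) ?_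
  exact revenueGap_nonneg (hardMarket α₀ α₁ κ m s ν σS τ)
    (by simp only [hardMarket]; linarith [show 0 < κ / τ ^ 2 by positivity]) x z a ha

/-- The left side is the divided difference of `mτ - τ²(e + a)` in `τ`. It splits into the deviation
from the optimal fee, the effect of `e`, and the second-order effect of `τ' - τ`; the constant is
`48 = 3 · 4²`, from three summands and `τ + τ' ≤ 4`. -/
theorem sq_sub_mul_le (hm : 0 < m) (hτ : 1 ≤ τ) (hτ2 : τ ≤ 2) (hτ' : 1 ≤ τ') (hτ2' : τ' ≤ 2)
    (e a : ℝ) :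
    (m - (τ + τ') * (e + a)) ^ 2 ≤
      48 * ((a - max 0 ((m / τ - e) / 2)) ^ 2 + e ^ 2) + m ^ 2 * (τ' - τ) ^ 2 := by
  have hτ0 : 0 < τ := by linarith
  set b := m / τ with hb
  have hmb : m = b * τ := by rw [hb]; field_simp
  have hb0 : 0 < b := by positivity
  set o := max 0 ((b - e) / 2) with ho
  -- `r` is the shift caused by supply noise: `e/2` if the optimal fee is interior, and `e - b/2` if
  -- it is clipped, in which case `e ≥ b`.
  have h1 : ∃ r : ℝ, e + a - b / 2 = (a - o) + r ∧ r ^ 2 ≤ e ^ 2 := by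
    rcases le_total 0 ((b - e) / 2) with h2 | h2
    · refine ⟨e / 2, ?_, by nlinarith [sq_nonneg e]⟩
      rw [ho, max_eq_right h2]
      ring
    · refine ⟨e - b / 2, ?_, by nlinarith⟩
      rw [ho, max_eq_left h2]
      ring
  obtain ⟨r, hr, hre⟩ := h1
  have h2 : m - (τ + τ') * (e + a) =
      -(τ + τ') * (a - o) - (τ + τ') * r - b * (τ' - τ) / 2 := by
    have : e + a = (a - o) + r + b / 2 := by linarith
    rw [this, hmb]
    ring
  rw [h2]
  have h3 : (τ + τ') ^ 2 ≤ 16 := by nlinarith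
  have h4 : b ^ 2 * (τ' - τ) ^ 2 ≤ m ^ 2 * (τ' - τ) ^ 2 := by
    gcongr
    rw [hmb]
    nlinarith
  have h5 : (τ + τ') ^ 2 * (a - o) ^ 2 ≤ 16 * (a - o) ^ 2 := by gcongr
  have h6 : (τ + τ') ^ 2 * r ^ 2 ≤ 16 * e ^ 2 := by gcongr
  have h7 : ∀ x y z : ℝ, (-x - y - z) ^ 2 ≤ 3 * (x ^ 2 + y ^ 2 + z ^ 2) := fun x y z => by
    nlinarith [sq_nonneg (x - y), sq_nonneg (y - z), sq_nonneg (x - z)]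
  have h8 := h7 ((τ + τ') * (a - o)) ((τ + τ') * r) (b * (τ' - τ) / 2)
  have h9 : 0 ≤ m ^ 2 * (τ' - τ) ^ 2 := by positivity
  rw [show -((τ + τ') * (a - o)) = -(τ + τ') * (a - o) by ring] at h8
  nlinarith

theorem separation_hardMarket_le (hκ : 0 < κ) (hs : 0 < s) (hm : 0 < m)
    (hτ : 1 ≤ τ) (hτ2 : τ ≤ 2) (hτ' : 1 ≤ τ') (hτ2' : τ' ≤ 2)
    (x : Fin d → ℝ) (z : ℝ) {a : ℝ} (ha : 0 ≤ a) :
    (hardMarket α₀ α₁ κ m s ν σS τ).separation (hardMarket α₀ α₁ κ m s ν σS τ') x z a ≤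
      ENNReal.ofReal ((τ' - τ) ^ 2 / (4 * s ^ 2)) *
        (ENNReal.ofReal (48 * κ) *
            ENNReal.ofReal ((hardMarket α₀ α₁ κ m s ν σS τ).revenueGap x z a) +
          (ENNReal.ofReal 48 * ENNReal.ofReal ((z - α₀) ^ 2) +
            ENNReal.ofReal (m ^ 2 * (τ' - τ) ^ 2))) := by
  have hτ0 : 0 < τ := by linarith
  have hτ0' : 0 < τ' := by linarith
  have hgap := sq_sub_optimalFee_le_mul_revenueGap_hardMarket (α₀ := α₀) (α₁ := α₁) (m := m)
    (s := s) (ν := ν) (σS := σS) hκ hτ x z ha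
  have hgap0 : 0 ≤ (hardMarket α₀ α₁ κ m s ν σS τ).revenueGap x z a :=
    revenueGap_nonneg _
      (by simp only [hardMarket]; linarith [show 0 < κ / τ ^ 2 by positivity]) x z a ha
  rw [← ENNReal.ofReal_mul (by positivity), ← ENNReal.ofReal_mul (by positivity),
    ← ENNReal.ofReal_add (by positivity) (by positivity),
    ← ENNReal.ofReal_add (by positivity) (by positivity), ← ENNReal.ofReal_mul (by positivity)]
  apply ENNReal.ofReal_le_ofReal
  rw [hardMarket_quantityVar hτ, Real.coe_toNNReal _ (sq_nonneg _)]
  have h1 := sq_sub_mul_le hm hτ hτ2 hτ' hτ2' (z - α₀) a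
  rw [show m / τ - (z - α₀) = α₀ + m / τ - z by ring] at h1
  have h2 : ((hardMarket α₀ α₁ κ m s ν σS τ').meanQuantity z x a -
      (hardMarket α₀ α₁ κ m s ν σS τ).meanQuantity z x a) ^ 2 / (4 * (s / κ) ^ 2) =
      (τ' - τ) ^ 2 / (4 * s ^ 2) * (m - (τ + τ') * (z - α₀ + a)) ^ 2 := by
    rw [hardMarket_meanQuantity hτ, hardMarket_meanQuantity hτ', ← sub_div,
      show m * τ' - τ' ^ 2 * (z - α₀ + a) - (m * τ - τ ^ 2 * (z - α₀ + a)) =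
        (τ' - τ) * (m - (τ + τ') * (z - α₀ + a)) by ring]
    field_simp
  rw [h2]
  gcongr
  linarith

theorem roundExp_separation_hardMarket_le [IsProbabilityMeasure ν]
    (hκ : 0 < κ) (hs : 0 < s) (hm : 0 < m)
    (hτ : 1 ≤ τ) (hτ2 : τ ≤ 2) (hτ' : 1 ≤ τ') (hτ2' : τ' ≤ 2)
    (π : PricingPolicy S d) (u : S) (t : ℕ) :
    ∫⁻ h, (hardMarket α₀ α₁ κ m s ν σS τ).roundExp π u t h
        ((hardMarket α₀ α₁ κ m s ν σS τ).separation (hardMarket α₀ α₁ κ m s ν σS τ'))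
        ∂(hardMarket α₀ α₁ κ m s ν σS τ).historyLaw π u t ≤
      ENNReal.ofReal ((τ' - τ) ^ 2 / (4 * s ^ 2)) *
        (ENNReal.ofReal (48 * κ) * (hardMarket α₀ α₁ κ m s ν σS τ).seedRegret π u t +
          ENNReal.ofReal (48 * σS ^ 2 + m ^ 2 * (τ' - τ) ^ 2)) := by
  set M := hardMarket α₀ α₁ κ m s ν σS τ with hM
  have : IsProbabilityMeasure M.ν := ‹IsProbabilityMeasure ν›
  have hf : Measurable M.f := measurable_const
  have := M.isProbabilityMeasure_historyLaw hf π u t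
  have hgm : Measurable fun p : (Fin d → ℝ) × ℝ × ℝ =>
      ENNReal.ofReal (48 * κ) * ENNReal.ofReal (M.revenueGap p.1 p.2.1 p.2.2) :=
    (ENNReal.measurable_ofReal.comp (M.measurable_revenueGap hf)).const_mul _
  have hsm : Measurable fun p : (Fin d → ℝ) × ℝ × ℝ =>
      ENNReal.ofReal 48 * ENNReal.ofReal ((p.2.1 - M.α₀) ^ 2) := by fun_prop
  have key : ∀ h, M.roundExp π u t h (M.separation (hardMarket α₀ α₁ κ m s ν σS τ')) ≤
      ENNReal.ofReal ((τ' - τ) ^ 2 / (4 * s ^ 2)) *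
        (ENNReal.ofReal (48 * κ) *
            M.roundExp π u t h (fun x s a => ENNReal.ofReal (M.revenueGap x s a)) +
          ENNReal.ofReal (48 * σS ^ 2 + m ^ 2 * (τ' - τ) ^ 2)) := by
    intro h
    refine (M.roundExp_mono π u t h fun x z a ha =>
      separation_hardMarket_le hκ hs hm hτ hτ2 hτ' hτ2' x z ha).trans_eq ?_
    rw [roundExp_const_mul _ _ _ _ _ _ ENNReal.ofReal_ne_top, M.roundExp_add_left π u t h hgm,
      M.roundExp_add_left π u t h hsm, roundExp_const_mul _ _ _ _ _ _ ENNReal.ofReal_ne_top,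
      roundExp_const_mul _ _ _ _ _ _ ENNReal.ofReal_ne_top, M.roundExp_const]
    have h1 : M.roundExp π u t h (fun _ z _ => ENNReal.ofReal ((z - α₀) ^ 2)) =
      ENNReal.ofReal (σS ^ 2) := M.roundExp_sq_supply π u t h
    rw [h1, ← ENNReal.ofReal_mul (by norm_num),
      ← ENNReal.ofReal_add (by positivity) (by positivity)]
  refine (lintegral_mono key).trans_eq ?_
  rw [lintegral_const_mul' _ _ ENNReal.ofReal_ne_top, lintegral_add_right _ measurable_const,
    lintegral_const_mul' _ _ ENNReal.ofReal_ne_top, lintegral_const, measure_univ, mul_one]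
  rfl

end hardMarket

end Market

/-! ### Two-point lower bound for the regret of one round -/

namespace Market

variable {d : ℕ} {S : Type*} [MeasurableSpace S]

section hardMarket

variable {α₀ α₁ κ m s σS τ τ' : ℝ} {ν : Measure (Fin d → ℝ)}

/-- One fee cannot be close to both optimal fees, whose distance is `m|τ' - τ|/(2ττ')` with `ττ' ≤
4`; hence `64 = 4 · 4²`. Here `k` stands for the root of the likelihood ratio, and the form `k - (1
+ k²)/4` is chosen because it integrates to the affinity minus `1/2`. -/
theorem revenueGap_hardMarket_add_ge (hκ : 0 < κ) (hm : 0 < m)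
    (hτ : 1 ≤ τ) (hτ2 : τ ≤ 2) (hτ' : 1 ≤ τ') (hτ2' : τ' ≤ 2)
    (x : Fin d → ℝ) {z a : ℝ} (ha : 0 ≤ a) (hz : z ≤ α₀) (k : ℝ) :
    m ^ 2 * (τ' - τ) ^ 2 / (64 * κ) * (k - (1 + k ^ 2) / 4) ≤
      (hardMarket α₀ α₁ κ m s ν σS τ).revenueGap x z a +
        k ^ 2 * (hardMarket α₀ α₁ κ m s ν σS τ').revenueGap x z a := by
  have hτ0 : 0 < τ := by linarith
  have hτ0' : 0 < τ' := by linarith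
  have h1 := sq_sub_optimalFee_le_mul_revenueGap_hardMarket (α₀ := α₀) (α₁ := α₁) (m := m)
    (s := s) (ν := ν) (σS := σS) hκ hτ x z ha
  have h2 := sq_sub_optimalFee_le_mul_revenueGap_hardMarket (α₀ := α₀) (α₁ := α₁) (m := m)
    (s := s) (ν := ν) (σS := σS) hκ hτ' x z ha
  have hb : 0 < m / τ := by positivity
  have hb' : 0 < m / τ' := by positivity
  rw [max_eq_right (by linarith)] at h1 h2
  set X := a - (α₀ + m / τ - z) / 2 with hX
  set Y := a - (α₀ + m / τ' - z) / 2 with hY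
  set G := (hardMarket α₀ α₁ κ m s ν σS τ).revenueGap x z a
  set G' := (hardMarket α₀ α₁ κ m s ν σS τ').revenueGap x z a
  have hXY : Y - X = m * (τ' - τ) / (2 * (τ * τ')) := by
    rw [hX, hY]
    field_simp
    ring
  have hD : m ^ 2 * (τ' - τ) ^ 2 / 64 ≤ (Y - X) ^ 2 := by
    rw [hXY, div_pow, mul_pow]
    apply div_le_div_of_nonneg_left (by positivity) (by positivity)
    have h4 : τ * τ' ≤ 4 := by nlinarith
    nlinarith [mul_pos hτ0 hτ0']
  -- For fixed `Y - X` the minimum of the right side is `(Y - X)² k²/(1 + k²)`, and `k²/(1 + k²) +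
  -- (1 + k²)/4 ≥ k` by AM-GM.
  have hmain : (Y - X) ^ 2 * (k - (1 + k ^ 2) / 4) ≤ X ^ 2 + k ^ 2 * Y ^ 2 := by
    nlinarith [sq_nonneg (X - k * (X - Y) / 2), sq_nonneg (k * Y + (X - Y) / 2)]
  have hG : X ^ 2 + k ^ 2 * Y ^ 2 ≤ κ * (G + k ^ 2 * G') := by nlinarith [sq_nonneg k]
  have hle : m ^ 2 * (τ' - τ) ^ 2 / 64 * (k - (1 + k ^ 2) / 4) ≤ κ * (G + k ^ 2 * G') := by
    rcases le_total 0 (k - (1 + k ^ 2) / 4) with h0 | h0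
    · exact (mul_le_mul_of_nonneg_right hD h0).trans (hmain.trans hG)
    · exact (mul_nonpos_of_nonneg_of_nonpos (by positivity) h0).trans
        (le_trans (by positivity) hG)
  have : m ^ 2 * (τ' - τ) ^ 2 / (64 * κ) * (k - (1 + k ^ 2) / 4) =
      (m ^ 2 * (τ' - τ) ^ 2 / 64 * (k - (1 + k ^ 2) / 4)) / κ := by
    field_simp
  rw [this, div_le_iff₀ hκ]
  linarith

theorem revenueGap_hardMarket_nonneg (hκ : 0 < κ) (hτ : 1 ≤ τ) (x : Fin d → ℝ) (z : ℝ) {a : ℝ}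
    (ha : 0 ≤ a) : 0 ≤ (hardMarket α₀ α₁ κ m s ν σS τ).revenueGap x z a :=
  revenueGap_nonneg _
    (by simp only [hardMarket]; linarith [show 0 < κ / τ ^ 2 by positivity]) x z a ha

theorem roundExp_revenueGap_hardMarket_add_ge [IsProbabilityMeasure ν]
    (hκ : 0 < κ) (hm : 0 < m)
    (hτ : 1 ≤ τ) (hτ2 : τ ≤ 2) (hτ' : 1 ≤ τ') (hτ2' : τ' ≤ 2)
    (π : PricingPolicy S d) (u : S) (t : ℕ) (h : Fin t → Observation d) {K : ℝ≥0∞}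
    (hK : K ≠ ∞) {q : ℝ} (hq : q = m ^ 2 * (τ' - τ) ^ 2 / (64 * κ)) :
    ENNReal.ofReal (q / 2) * K ≤
      (hardMarket α₀ α₁ κ m s ν σS τ).roundExp π u t h (fun x z a =>
          ENNReal.ofReal ((hardMarket α₀ α₁ κ m s ν σS τ).revenueGap x z a)) +
        K ^ 2 * (hardMarket α₀ α₁ κ m s ν σS τ').roundExp π u t h (fun x z a =>
          ENNReal.ofReal ((hardMarket α₀ α₁ κ m s ν σS τ').revenueGap x z a)) +
        ENNReal.ofReal (q / 8) * (1 + K ^ 2) := by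
  set M := hardMarket α₀ α₁ κ m s ν σS τ with hM
  set M' := hardMarket α₀ α₁ κ m s ν σS τ' with hM'
  have : IsProbabilityMeasure M.ν := ‹IsProbabilityMeasure ν›
  have hroundExp : ∀ g, M'.roundExp π u t h g = M.roundExp π u t h g := fun _ => rfl
  rw [hroundExp, ← roundExp_const_mul _ _ _ _ _ _ (ENNReal.pow_ne_top hK),
    ← M.roundExp_add_left π u t h
      (ENNReal.measurable_ofReal.comp (M.measurable_revenueGap measurable_const))]
  have hq0 : 0 ≤ q := by rw [hq]; positivity
  obtain ⟨k, hk, rfl⟩ : ∃ k : ℝ, 0 ≤ k ∧ K = ENNReal.ofReal k :=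
    ⟨K.toReal, ENNReal.toReal_nonneg, (ENNReal.ofReal_toReal hK).symm⟩
  have hge := M.half_mul_le_roundExp π u t h
    (g := fun x z a => ENNReal.ofReal (M.revenueGap x z a) +
      ENNReal.ofReal k ^ 2 * ENNReal.ofReal (M'.revenueGap x z a))
    (c := ENNReal.ofReal (q * (k - (1 + k ^ 2) / 4))) (fun x z a ha hz => by
      rw [← ENNReal.ofReal_pow hk, ← ENNReal.ofReal_mul (by positivity),
        ← ENNReal.ofReal_add (revenueGap_hardMarket_nonneg hκ hτ x z ha)
          (mul_nonneg (by positivity) (revenueGap_hardMarket_nonneg hκ hτ' x z ha))]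
      apply ENNReal.ofReal_le_ofReal
      rw [hq]
      exact revenueGap_hardMarket_add_ge hκ hm hτ hτ2 hτ' hτ2' x ha hz k)
  refine le_trans ?_ (add_le_add hge le_rfl)
  have h2 : (2⁻¹ : ℝ≥0∞) = ENNReal.ofReal 2⁻¹ := by
    rw [ENNReal.ofReal_inv_of_pos (by norm_num)]; simp
  rw [h2, ← ENNReal.ofReal_pow hk, ← ENNReal.ofReal_one,
    ← ENNReal.ofReal_add (by norm_num) (by positivity), ← ENNReal.ofReal_mul (by positivity),
    ← ENNReal.ofReal_mul (by positivity), ← ENNReal.ofReal_mul (by positivity)]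
  refine le_trans ?_ ENNReal.ofReal_add_le
  apply ENNReal.ofReal_le_ofReal
  apply le_of_eq
  ring

/-- Two hard markets cannot both have a small regret in round `t`, unless the first `t` rounds
discriminate between them. -/
theorem le_seedRegret_hardMarket_add [IsProbabilityMeasure ν]
    (hκ : 0 < κ) (hs : 0 < s) (hm : 0 < m)
    (hτ : 1 ≤ τ) (hτ2 : τ ≤ 2) (hτ' : 1 ≤ τ') (hτ2' : τ' ≤ 2)
    (π : PricingPolicy S d) (u : S) (t : ℕ)
    {q : ℝ} (hq : q = m ^ 2 * (τ' - τ) ^ 2 / (64 * κ)) :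
    ENNReal.ofReal (q / 4) ≤
      (hardMarket α₀ α₁ κ m s ν σS τ).seedRegret π u t +
        (hardMarket α₀ α₁ κ m s ν σS τ').seedRegret π u t +
      ENNReal.ofReal (q / 4) * ∑ i ∈ Finset.range t,
        ENNReal.ofReal ((τ' - τ) ^ 2 / (4 * s ^ 2)) *
          (ENNReal.ofReal (48 * κ) * ((hardMarket α₀ α₁ κ m s ν σS τ).seedRegret π u i +
              (hardMarket α₀ α₁ κ m s ν σS τ').seedRegret π u i) +
            ENNReal.ofReal (2 * (48 * σS ^ 2 + m ^ 2 * (τ' - τ) ^ 2))) := by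
  have H : SameNoise (hardMarket α₀ α₁ κ m s ν σS τ) (hardMarket α₀ α₁ κ m s ν σS τ') :=
    hardMarket_sameNoise hκ hs hτ hτ'
  have hsep := fun i => roundExp_separation_hardMarket_le (α₀ := α₀) (α₁ := α₁) (σS := σS)
    (ν := ν) hκ hs hm hτ hτ2 hτ' hτ2' π u i
  have hsep' := fun i => roundExp_separation_hardMarket_le (α₀ := α₀) (α₁ := α₁) (σS := σS)
    (ν := ν) hκ hs hm hτ' hτ2' hτ hτ2 π u i
  have hpt := fun h K hK => roundExp_revenueGap_hardMarket_add_ge (α₀ := α₀) (α₁ := α₁) (s := s)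
    (σS := σS) (ν := ν) hκ hm hτ hτ2 hτ' hτ2' π u t h (K := K) hK hq
  set M := hardMarket α₀ α₁ κ m s ν σS τ with hM
  set M' := hardMarket α₀ α₁ κ m s ν σS τ' with hM'
  have : IsProbabilityMeasure M.ν := ‹IsProbabilityMeasure ν›
  have : IsProbabilityMeasure M'.ν := ‹IsProbabilityMeasure ν›
  have := M.isProbabilityMeasure_historyLaw H.measurable_f π u t
  have hq0 : 0 ≤ q := by rw [hq]; positivity
  have hKm := H.measurable_historyRootRatio t
  have hG := M.measurable_roundExp_revenueGap H.measurable_f π t (measurable_const (a := u))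
    (measurable_id (α := Fin t → Observation d))
  have hG' := M'.measurable_roundExp_revenueGap H.measurable_f' π t (measurable_const (a := u))
    (measurable_id (α := Fin t → Observation d))
  simp only [id] at hG hG'
  have h8 : ENNReal.ofReal (q / 8) * (1 + 1) = ENNReal.ofReal (q / 4) := by
    rw [mul_add, mul_one, ← ENNReal.ofReal_add (by positivity) (by positivity)]
    congr 1
    ring
  -- Integration turns `K²` times the gap in `M'` into the regret under the law of `M'`, and `1 +
  -- K²` into `2`.
  have h1 : ENNReal.ofReal (q / 2) * ∫⁻ h, M.historyRootRatio M' h ∂M.historyLaw π u t ≤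
      M.seedRegret π u t + M'.seedRegret π u t + ENNReal.ofReal (q / 4) := by
    rw [← lintegral_const_mul' _ _ ENNReal.ofReal_ne_top]
    refine (lintegral_mono fun h => hpt h _ (M.historyRootRatio_ne_top M' h)).trans_eq ?_
    rw [lintegral_add_right _ (by fun_prop), lintegral_add_left hG,
      lintegral_const_mul' _ _ ENNReal.ofReal_ne_top, lintegral_add_left measurable_const,
      H.lintegral_historyRootRatio_sq, ← H.lintegral_historyLaw_eq π u t hG',
      lintegral_const, measure_univ, one_mul, h8]
    rfl
  have h2 := H.one_le_lintegral_historyRootRatio_add π u t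
  have h3 : 2⁻¹ * ENNReal.ofReal (q / 2) = ENNReal.ofReal (q / 4) := by
    have h2 : (2⁻¹ : ℝ≥0∞) = ENNReal.ofReal 2⁻¹ := by
      rw [ENNReal.ofReal_inv_of_pos (by norm_num)]; simp
    rw [h2, ← ENNReal.ofReal_mul (by norm_num)]
    congr 1
    ring
  have h4 : ENNReal.ofReal (q / 4) + ENNReal.ofReal (q / 4) = ENNReal.ofReal (q / 2) := by
    rw [← ENNReal.ofReal_add (by positivity) (by positivity)]
    congr 1
    ring
  -- The affinity bound contributes `q/2`, of which `q/4` pays for the term `(1 + K²)/4`; the other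
  -- `q/4` is the lower bound.
  refine (ENNReal.add_le_add_iff_left (ENNReal.ofReal_ne_top (r := q / 4))).1 ?_
  rw [h4]
  calc ENNReal.ofReal (q / 2) = ENNReal.ofReal (q / 2) * 1 := (mul_one _).symm
    _ ≤ ENNReal.ofReal (q / 2) * (∫⁻ h, M.historyRootRatio M' h ∂M.historyLaw π u t +
        2⁻¹ * ∑ i ∈ Finset.range t,
          (∫⁻ h, M.roundExp π u i h (M.separation M') ∂M.historyLaw π u i +
            ∫⁻ h, M'.roundExp π u i h (M'.separation M) ∂M'.historyLaw π u i)) := by gcongr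
    _ ≤ M.seedRegret π u t + M'.seedRegret π u t + ENNReal.ofReal (q / 4) +
        ENNReal.ofReal (q / 4) * ∑ i ∈ Finset.range t,
          (∫⁻ h, M.roundExp π u i h (M.separation M') ∂M.historyLaw π u i +
            ∫⁻ h, M'.roundExp π u i h (M'.separation M) ∂M'.historyLaw π u i) := by
      rw [mul_add, ← mul_assoc, mul_comm _ 2⁻¹, h3]
      gcongr
    _ ≤ _ := by
      rw [add_comm _ (ENNReal.ofReal (q / 4)), add_assoc]
      gcongr with i hi
      refine (add_le_add (hsep i) (hsep' i)).trans_eq ?_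
      have h5 : ENNReal.ofReal (2 * (48 * σS ^ 2 + m ^ 2 * (τ' - τ) ^ 2)) =
          2 * ENNReal.ofReal (48 * σS ^ 2 + m ^ 2 * (τ' - τ) ^ 2) := by
        rw [ENNReal.ofReal_mul (by norm_num)]
        simp
      rw [← neg_sub τ' τ, neg_sq, ← mul_add, h5]
      congr 1
      ring

theorem le_roundRegret_hardMarket_add [IsProbabilityMeasure ν]
    (hκ : 0 < κ) (hs : 0 < s) (hm : 0 < m)
    (hτ : 1 ≤ τ) (hτ2 : τ ≤ 2) (hτ' : 1 ≤ τ') (hτ2' : τ' ≤ 2)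
    (ρ : Measure S) [IsProbabilityMeasure ρ] (π : PricingPolicy S d) (t : ℕ)
    {q : ℝ} (hq : q = m ^ 2 * (τ' - τ) ^ 2 / (64 * κ)) :
    ENNReal.ofReal (q / 4) ≤
      (hardMarket α₀ α₁ κ m s ν σS τ).roundRegret ρ π t +
        (hardMarket α₀ α₁ κ m s ν σS τ').roundRegret ρ π t +
      ENNReal.ofReal (q / 4) * ∑ i ∈ Finset.range t,
        ENNReal.ofReal ((τ' - τ) ^ 2 / (4 * s ^ 2)) *
          (ENNReal.ofReal (48 * κ) * ((hardMarket α₀ α₁ κ m s ν σS τ).roundRegret ρ π i +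
              (hardMarket α₀ α₁ κ m s ν σS τ').roundRegret ρ π i) +
            ENNReal.ofReal (2 * (48 * σS ^ 2 + m ^ 2 * (τ' - τ) ^ 2))) := by
  have key := fun u => le_seedRegret_hardMarket_add (α₀ := α₀) (α₁ := α₁) (σS := σS)
    (ν := ν) hκ hs hm hτ hτ2 hτ' hτ2' π u t hq
  set M := hardMarket α₀ α₁ κ m s ν σS τ with hM
  set M' := hardMarket α₀ α₁ κ m s ν σS τ' with hM'
  have : IsProbabilityMeasure M.ν := ‹IsProbabilityMeasure ν›
  have : IsProbabilityMeasure M'.ν := ‹IsProbabilityMeasure ν›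
  have hf : Measurable M.f := measurable_const
  have hf' : Measurable M'.f := measurable_const
  have hm1 := fun i => M.measurable_seedRegret hf π i
  have hm2 := fun i => M'.measurable_seedRegret hf' π i
  simp_rw [M.roundRegret_eq_lintegral_seedRegret hf, M'.roundRegret_eq_lintegral_seedRegret hf']
  calc ENNReal.ofReal (q / 4) = ∫⁻ _, ENNReal.ofReal (q / 4) ∂ρ := by simp
    _ ≤ _ := lintegral_mono key
    _ = _ := by
      rw [lintegral_add_left (by fun_prop), lintegral_add_left (hm1 t),
        lintegral_const_mul' _ _ ENNReal.ofReal_ne_top,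
        lintegral_finsetSum _ (fun i _ => by fun_prop)]
      congr 2
      refine Finset.sum_congr rfl fun i _ => ?_
      rw [lintegral_const_mul' _ _ ENNReal.ofReal_ne_top, lintegral_add_right _ measurable_const,
        lintegral_const_mul' _ _ ENNReal.ofReal_ne_top, lintegral_add_left (hm1 i),
        lintegral_const, measure_univ, mul_one]

/-- If two hard markets both have cumulative regret at most `R` and are close enough, then the
regret of round `t` is bounded below in one of them. -/
theorem le_roundRegret_hardMarket_add_of_close [IsProbabilityMeasure ν]
    (hκ : 0 < κ) (hs : 0 < s) (hm : 0 < m)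
    (hτ : 1 ≤ τ) (hτ2 : τ ≤ 2) (hτ' : 1 ≤ τ') (hτ2' : τ' ≤ 2)
    (ρ : Measure S) [IsProbabilityMeasure ρ] (π : PricingPolicy S d) {t T : ℕ} (ht : t ≤ T)
    {R : ℝ} (hR : 0 ≤ R)
    (hR1 : (hardMarket α₀ α₁ κ m s ν σS τ).regret ρ π T ≤ ENNReal.ofReal R)
    (hR2 : (hardMarket α₀ α₁ κ m s ν σS τ').regret ρ π T ≤ ENNReal.ofReal R)
    (hclose : (τ' - τ) ^ 2 / (4 * s ^ 2) *
      (96 * κ * R + t * (2 * (48 * σS ^ 2 + m ^ 2 * (τ' - τ) ^ 2))) ≤ 1 / 2) :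
    ENNReal.ofReal (m ^ 2 * (τ' - τ) ^ 2 / (512 * κ)) ≤
      (hardMarket α₀ α₁ κ m s ν σS τ).roundRegret ρ π t +
        (hardMarket α₀ α₁ κ m s ν σS τ').roundRegret ρ π t := by
  set q := m ^ 2 * (τ' - τ) ^ 2 / (64 * κ) with hq
  have hq0 : 0 ≤ q := by rw [hq]; positivity
  have h1 := le_roundRegret_hardMarket_add (α₀ := α₀) (α₁ := α₁) (σS := σS)
    (ν := ν) hκ hs hm hτ hτ2 hτ' hτ2' ρ π t hq
  have h512 : m ^ 2 * (τ' - τ) ^ 2 / (512 * κ) = q / 8 := by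
    rw [hq, div_div]
    congr 1
    ring
  rw [h512]
  have hsub : ∀ M : Market d, M.regret ρ π T ≤ ENNReal.ofReal R →
      ∑ i ∈ Finset.range t, M.roundRegret ρ π i ≤ ENNReal.ofReal R := fun M hM =>
    (Finset.sum_le_sum_of_subset (Finset.range_mono ht)).trans hM
  have h2 : ENNReal.ofReal (q / 4) * ∑ i ∈ Finset.range t,
        ENNReal.ofReal ((τ' - τ) ^ 2 / (4 * s ^ 2)) *
          (ENNReal.ofReal (48 * κ) * ((hardMarket α₀ α₁ κ m s ν σS τ).roundRegret ρ π i +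
              (hardMarket α₀ α₁ κ m s ν σS τ').roundRegret ρ π i) +
            ENNReal.ofReal (2 * (48 * σS ^ 2 + m ^ 2 * (τ' - τ) ^ 2))) ≤
      ENNReal.ofReal (q / 8) := by
    rw [← Finset.mul_sum, Finset.sum_add_distrib, ← Finset.mul_sum, Finset.sum_add_distrib,
      Finset.sum_const, Finset.card_range, nsmul_eq_mul]
    calc _ ≤ ENNReal.ofReal (q / 4) * (ENNReal.ofReal ((τ' - τ) ^ 2 / (4 * s ^ 2)) *
          (ENNReal.ofReal (48 * κ) * (ENNReal.ofReal R + ENNReal.ofReal R) +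
            t * ENNReal.ofReal (2 * (48 * σS ^ 2 + m ^ 2 * (τ' - τ) ^ 2)))) := by
          gcongr
          · exact hsub _ hR1
          · exact hsub _ hR2
      _ ≤ ENNReal.ofReal (q / 4 * ((τ' - τ) ^ 2 / (4 * s ^ 2) *
          (96 * κ * R + t * (2 * (48 * σS ^ 2 + m ^ 2 * (τ' - τ) ^ 2))))) := by
          rw [← ENNReal.ofReal_natCast t, ← ENNReal.ofReal_add hR hR,
            ← ENNReal.ofReal_mul (by positivity), ← ENNReal.ofReal_mul (by positivity),
            ← ENNReal.ofReal_add (by positivity) (by positivity),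
            ← ENNReal.ofReal_mul (by positivity), ← ENNReal.ofReal_mul (by positivity)]
          apply le_of_eq
          congr 1
          ring
      _ ≤ ENNReal.ofReal (q / 8) := by
          apply ENNReal.ofReal_le_ofReal
          nlinarith
  have h3 := h1.trans (add_le_add le_rfl h2)
  have h4 : ENNReal.ofReal (q / 4) = ENNReal.ofReal (q / 8) + ENNReal.ofReal (q / 8) := by
    rw [← ENNReal.ofReal_add (by positivity) (by positivity)]
    congr 1
    ring
  rw [h4] at h3
  exact (ENNReal.add_le_add_iff_right ENNReal.ofReal_ne_top).1 h3

end hardMarket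

end Market

/-! ### Elementary estimates -/

/-- There are `N - n ≥ N/2` pairs `(j, j + n)`, and each index lies in at most two of them. -/
theorem mul_le_four_mul_sum_of_le_add_shift (f : ℕ → ℝ≥0∞) {n N : ℕ} (hn : 2 * n ≤ N) {B : ℝ≥0∞}
    (hB : ∀ j, j + n < N → B ≤ f j + f (j + n)) :
    N * B ≤ 4 * ∑ j ∈ Finset.range N, f j := by
  have h1 : ((N - n : ℕ) : ℝ≥0∞) * B ≤ 2 * ∑ j ∈ Finset.range N, f j := by
    calc ((N - n : ℕ) : ℝ≥0∞) * B = ∑ _j ∈ Finset.range (N - n), B := by simp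
      _ ≤ ∑ j ∈ Finset.range (N - n), (f j + f (j + n)) :=
        Finset.sum_le_sum fun j hj => hB j (by have := Finset.mem_range.1 hj; omega)
      _ = ∑ j ∈ Finset.range (N - n), f j + ∑ j ∈ Finset.range (N - n), f (n + j) := by
        rw [Finset.sum_add_distrib]
        simp_rw [add_comm n]
      _ ≤ ∑ j ∈ Finset.range N, f j + ∑ j ∈ Finset.range N, f j := by
        refine add_le_add (Finset.sum_le_sum_of_subset (Finset.range_mono (by omega))) ?_
        conv_rhs => rw [show N = n + (N - n) by omega, Finset.sum_range_add]
        exact le_add_self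
      _ = 2 * ∑ j ∈ Finset.range N, f j := (two_mul _).symm
  calc (N : ℝ≥0∞) * B ≤ ((2 * (N - n) : ℕ) : ℝ≥0∞) * B := by
        gcongr
        omega
    _ = 2 * (((N - n : ℕ) : ℝ≥0∞) * B) := by push_cast; ring
    _ ≤ 2 * (2 * ∑ j ∈ Finset.range N, f j) := by gcongr
    _ = 4 * ∑ j ∈ Finset.range N, f j := by rw [← mul_assoc]; norm_num

theorem log_sub_log_le_mul_sum {X v : ℝ} (hX : 0 < X) (hv : 0 < v) (n : ℕ) :
    Real.log (X + v * n) - Real.log X ≤ v * ∑ t ∈ Finset.range n, 1 / (X + v * t) := by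
  induction n with
  | zero => simp
  | succ n ih =>
    rw [Finset.sum_range_succ, mul_add]
    have hp : 0 < X + v * n := by positivity
    have hp' : 0 < X + v * (n + 1 : ℕ) := by positivity
    have h1 := Real.log_le_sub_one_of_pos (div_pos hp' hp)
    rw [Real.log_div hp'.ne' hp.ne'] at h1
    have h2 : (X + v * (n + 1 : ℕ)) / (X + v * n) - 1 = v * (1 / (X + v * n)) := by
      push_cast
      field_simp
      ring
    linarith

theorem log_one_add_div_le_sum {v : ℝ} (hv : 0 < v) {T : ℕ} (hT : 1 ≤ T) :
    Real.log (1 + v * √T) / v ≤ ∑ t ∈ Finset.range T, 1 / (√T + v * t) := by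
  have hT' : (0 : ℝ) < T := by exact_mod_cast hT
  have hX : 0 < √(T : ℝ) := Real.sqrt_pos.2 hT'
  have h := log_sub_log_le_mul_sum hX hv T
  rw [← Real.log_div (by positivity) hX.ne'] at h
  have h1 : (√(T : ℝ) + v * T) / √T = 1 + v * √T := by
    nth_rewrite 2 [← Real.mul_self_sqrt hT'.le]
    field_simp
  rw [h1] at h
  rw [div_le_iff₀ hv]
  linarith

/-- If `σ²√T ≤ 1`, then `log(1 + y) ≥ y/2` yields the bound by `√T`. Otherwise `log √T ≤ log(1 +
σ²√T) + 2 max(0, log(1/σ))`, and `log(1 + σ²√T) ≥ 1/2` turns this sum into a product. -/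
theorem min_sqrt_log_le {σ : ℝ} (hσ : 0 < σ) {T : ℕ} (hT : 1 ≤ T) :
    min √T (Real.log T / (σ ^ 2 * (1 + max 0 (Real.log (1 / σ))))) ≤
      16 * (Real.log (1 + σ ^ 2 * √T) / σ ^ 2) := by
  have hT' : (1 : ℝ) ≤ T := by exact_mod_cast hT
  set X := √(T : ℝ) with hX
  have hX1 : 1 ≤ X := Real.one_le_sqrt.2 hT'
  have hlogT : Real.log T = 2 * Real.log X := by
    rw [hX, Real.log_sqrt (by linarith)]
    ring
  set v := σ ^ 2 with hv
  have hv0 : 0 < v := by positivity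
  set l := max 0 (Real.log (1 / σ)) with hl
  have hl0 : 0 ≤ l := le_max_left _ _
  have hlogX : 0 ≤ Real.log X := Real.log_nonneg hX1
  rw [← mul_div_assoc, le_div_iff₀ hv0]
  rcases le_total (v * X) 1 with h | h
  · have h1 := Real.one_sub_inv_le_log_of_pos (show 0 < 1 + v * X by positivity)
    have h2 : v * X / 2 ≤ 1 - (1 + v * X)⁻¹ := by
      have hp : 0 < 1 + v * X := by positivity
      rw [show 1 - (1 + v * X)⁻¹ = v * X / (1 + v * X) by field_simp; ring]
      exact div_le_div_of_nonneg_left (by positivity) hp (by linarith)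
    have h3 := mul_le_mul_of_nonneg_right
      (min_le_left X (Real.log T / (v * (1 + l)))) hv0.le
    have h4 : 0 ≤ v * X := by positivity
    linarith
  · have h3 := mul_le_mul_of_nonneg_right
      (min_le_right X (Real.log T / (v * (1 + l)))) hv0.le
    have h4 : Real.log T / (v * (1 + l)) * v = 2 * Real.log X / (1 + l) := by
      rw [hlogT]
      field_simp
    rw [h4] at h3
    refine h3.trans ?_
    rw [div_le_iff₀ (by positivity)]
    have hlog2 : 1 / 2 ≤ Real.log (1 + v * X) :=
      (by linarith [Real.log_two_gt_d9] : (1 : ℝ) / 2 ≤ Real.log 2).trans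
        (Real.log_le_log (by norm_num) (by linarith))
    have hlogv : Real.log v = 2 * Real.log σ := by rw [hv, Real.log_pow]; norm_num
    have hlv : - Real.log v ≤ 2 * l := by
      have h5 : Real.log (1 / σ) ≤ l := le_max_right _ _
      rw [one_div, Real.log_inv] at h5
      linarith
    have hlogvX : Real.log X - 2 * l ≤ Real.log (1 + v * X) := by
      have h6 : Real.log (v * X) ≤ Real.log (1 + v * X) :=
        Real.log_le_log (by positivity) (by linarith)
      rw [Real.log_mul hv0.ne' (by positivity)] at h6
      linarith
    nlinarith [mul_nonneg hl0 (by linarith : 0 ≤ Real.log (1 + v * X) - 1 / 2)]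

/-! ### Averaging over a grid of hard markets and summing over rounds -/

namespace Market

variable {d : ℕ} {S : Type*} [MeasurableSpace S]

/-- If the regret is uniformly small along the family of hard markets, then the average over a fine
grid of the regret of a round is bounded below. -/
theorem mul_le_sum_roundRegret_hardMarket {α₀ α₁ κ m s σS D η : ℝ} {ν : Measure (Fin d → ℝ)}
    [IsProbabilityMeasure ν] (hκ : 0 < κ) (hs : 0 < s) (hm : 0 < m) (hD : 0 < D) (hD1 : D ≤ 1)
    (hη : 0 < η) (hηD : η ≤ D ^ 2 / 4) (hηs : η * (96 * κ + 96 + 2 * m ^ 2) ≤ 2 * s ^ 2)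
    (ρ : Measure S) [IsProbabilityMeasure ρ] (π : PricingPolicy S d) {t T : ℕ} (ht : t < T)
    {R : ℝ} (hR : 0 ≤ R) (hRT : R ≤ √T)
    (hreg : ∀ τ, 1 ≤ τ → τ ≤ 1 + D →
      (hardMarket α₀ α₁ κ m s ν σS τ).regret ρ π T ≤ ENNReal.ofReal R)
    {N : ℕ} (hN : D ≤ N * √(η / (√T + σS ^ 2 * t))) :
    N * ENNReal.ofReal (m ^ 2 / (2048 * κ) * (η / (√T + σS ^ 2 * t))) ≤
      4 * ∑ j ∈ Finset.range N,
        (hardMarket α₀ α₁ κ m s ν σS (1 + D * j / N)).roundRegret ρ π t := by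
  have hT : (1 : ℝ) ≤ T := by exact_mod_cast (by omega : 1 ≤ T)
  have htT : (t : ℝ) ≤ T := by exact_mod_cast ht.le
  set X := √(T : ℝ) with hX
  have hX1 : 1 ≤ X := Real.one_le_sqrt.2 hT
  have hXT : X ^ 2 = T := Real.sq_sqrt (by linarith)
  have hden : 0 < X + σS ^ 2 * t := by positivity
  set x := η / (X + σS ^ 2 * t) with hx
  have hx0 : 0 < x := by positivity
  have hη1 : η ≤ 1 := by linarith [pow_le_one₀ (n := 2) hD.le hD1]
  have hxη : x ≤ η := div_le_self hη.le (by nlinarith [mul_nonneg (sq_nonneg σS) t.cast_nonneg])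
  have hxden : x * X + x * (σS ^ 2 * t) = η := by rw [← mul_add, hx]; field_simp
  have hxX0 : 0 ≤ x * X := by positivity
  have hxv0 : 0 ≤ x * (σS ^ 2 * t) := by positivity
  have hxX : x * X ≤ η := by linarith
  have hxv : x * (σS ^ 2 * t) ≤ η := by linarith
  set y := √x with hy
  have hy0 : 0 < y := Real.sqrt_pos.2 hx0
  have hy2 : y ^ 2 = x := Real.sq_sqrt hx0.le
  have hyD : y ≤ D / 2 := by
    refine Real.sqrt_le_iff.2 ⟨by linarith, ?_⟩
    rw [div_pow]
    linarith
  have hN0 : (0 : ℝ) < N := by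
    by_contra h
    linarith [mul_nonpos_of_nonpos_of_nonneg (not_lt.1 h) hy0.le]
  -- The pairs are `n` grid steps apart, with `n` the largest number of steps of total length at
  -- most `y`. Then `n ≥ 1`, so rounding loses at most a factor `2` in the distance and `4` in its
  -- square.
  set n := ⌊N * y / D⌋₊ with hn
  have hnle : (n : ℝ) ≤ N * y / D := Nat.floor_le (by positivity)
  have hnge : N * y / D < n + 1 := Nat.lt_floor_add_one _
  have hone : 1 ≤ N * y / D := by rwa [le_div_iff₀ hD, one_mul]
  have hn1 : (1 : ℝ) ≤ n := by exact_mod_cast Nat.one_le_floor_iff _ |>.2 hone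
  have hnD : D * n / N ≤ y := by
    rw [le_div_iff₀ hD] at hnle
    rw [div_le_iff₀ hN0]
    linarith
  have hnD' : y / 2 ≤ D * n / N := by
    have h1 : N * y / D ≤ 2 * n := by linarith
    rw [div_le_iff₀ hD] at h1
    rw [le_div_iff₀ hN0]
    linarith
  have h2n : 2 * n ≤ N := by
    have h1 : D * (2 * n) ≤ D * N := by
      rw [div_le_iff₀ hN0] at hnD
      have h2 := mul_le_mul_of_nonneg_right hyD hN0.le
      linarith
    exact_mod_cast le_of_mul_le_mul_left h1 hD
  refine mul_le_four_mul_sum_of_le_add_shift _ h2n fun j hj => ?_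
  set τ := 1 + D * j / N with hτ
  have hτ' : (1 + D * ((j + n : ℕ) : ℝ) / N) = τ + D * n / N := by
    rw [hτ]
    push_cast
    ring
  rw [hτ']
  set δ := D * n / N with hδ
  have hδ0 : 0 < δ := by linarith
  have hτ1 : 1 ≤ τ := by
    rw [hτ]
    have : 0 ≤ D * j / N := by positivity
    linarith
  have hτD : τ + δ ≤ 1 + D := by
    rw [← hτ']
    have h1 : ((j + n : ℕ) : ℝ) ≤ N := by exact_mod_cast hj.le
    have h2 : D * ((j + n : ℕ) : ℝ) / N ≤ D := by
      rw [div_le_iff₀ hN0]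
      gcongr
    linarith
  have hδx : δ ^ 2 ≤ x := by
    rw [← hy2]
    gcongr
  have hδx' : x / 4 ≤ δ ^ 2 := by
    calc x / 4 = (y / 2) ^ 2 := by rw [← hy2]; ring
      _ ≤ δ ^ 2 := by gcongr
  -- The term `√T` in the denominator of `x` absorbs both `R ≤ √T` and the second-order information
  -- `t x²`; the term `σS² t` absorbs the information from supply noise.
  have hclose : (τ + δ - τ) ^ 2 / (4 * s ^ 2) *
      (96 * κ * R + t * (2 * (48 * σS ^ 2 + m ^ 2 * (τ + δ - τ) ^ 2))) ≤ 1 / 2 := by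
    rw [add_sub_cancel_left, div_mul_eq_mul_div, div_le_iff₀ (by positivity)]
    have h1 : x * (96 * κ * X) ≤ 96 * κ * η := by
      calc x * (96 * κ * X) = 96 * κ * (x * X) := by ring
        _ ≤ 96 * κ * η := by gcongr
    have h2 : x * (t * (96 * σS ^ 2)) ≤ 96 * η := by linarith
    have h3 : x * (t * (2 * (m ^ 2 * x))) ≤ 2 * m ^ 2 * η := by
      have h5 : x ^ 2 * t ≤ η := by
        calc x ^ 2 * t ≤ x ^ 2 * T := by gcongr
          _ = (x * X) ^ 2 := by rw [mul_pow, hXT]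
          _ ≤ η ^ 2 := by gcongr
          _ ≤ η := pow_le_of_le_one hη.le hη1 two_ne_zero
      calc x * (t * (2 * (m ^ 2 * x))) = 2 * m ^ 2 * (x ^ 2 * t) := by ring
        _ ≤ 2 * m ^ 2 * η := by gcongr
    calc δ ^ 2 * (96 * κ * R + t * (2 * (48 * σS ^ 2 + m ^ 2 * δ ^ 2)))
        ≤ x * (96 * κ * X + t * (2 * (48 * σS ^ 2 + m ^ 2 * x))) := by gcongr
      _ = x * (96 * κ * X) + x * (t * (96 * σS ^ 2)) + x * (t * (2 * (m ^ 2 * x))) := by ring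
      _ ≤ 1 / 2 * (4 * s ^ 2) := by linarith
  have hmain := le_roundRegret_hardMarket_add_of_close (α₀ := α₀) (α₁ := α₁) (σS := σS)
    (ν := ν) hκ hs hm hτ1 (by linarith) (by linarith : 1 ≤ τ + δ) (by linarith) ρ π ht.le hR
    (hreg τ hτ1 (by linarith)) (hreg (τ + δ) (by linarith) hτD) hclose
  refine le_trans (ENNReal.ofReal_le_ofReal ?_) hmain
  rw [add_sub_cancel_left]
  calc m ^ 2 / (2048 * κ) * x = m ^ 2 * (x / 4) / (512 * κ) := by field_simp; norm_num
    _ ≤ m ^ 2 * δ ^ 2 / (512 * κ) := by gcongr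

theorem log_le_of_regret_hardMarket_le {α₀ α₁ κ m s σS D η : ℝ} {ν : Measure (Fin d → ℝ)}
    [IsProbabilityMeasure ν] (hκ : 0 < κ) (hs : 0 < s) (hm : 0 < m) (hD : 0 < D) (hD1 : D ≤ 1)
    (hη : 0 < η) (hηD : η ≤ D ^ 2 / 4) (hηs : η * (96 * κ + 96 + 2 * m ^ 2) ≤ 2 * s ^ 2)
    (hσS : 0 < σS)
    (ρ : Measure S) [IsProbabilityMeasure ρ] (π : PricingPolicy S d) {T : ℕ} (hT : 1 ≤ T)
    {R : ℝ} (hR : 0 ≤ R) (hRT : R ≤ √T)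
    (hreg : ∀ τ, 1 ≤ τ → τ ≤ 1 + D →
      (hardMarket α₀ α₁ κ m s ν σS τ).regret ρ π T ≤ ENNReal.ofReal R) :
    m ^ 2 * η / (8192 * κ) * (Real.log (1 + σS ^ 2 * √T) / σS ^ 2) ≤ R := by
  have hT' : (1 : ℝ) ≤ T := by exact_mod_cast hT
  have hX : 0 < √(T : ℝ) := Real.sqrt_pos.2 (by linarith)
  -- The grid is fitted to `t = T`, where the distance is smallest, so that one grid serves all
  -- rounds and the sums over rounds and grid points can be exchanged.
  obtain ⟨N, hN⟩ := exists_nat_ge (D / √(η / (√T + σS ^ 2 * T)))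
  have hy : 0 < √(η / (√T + σS ^ 2 * T)) := Real.sqrt_pos.2 (by positivity)
  have hNpos : (0 : ℝ) < N := lt_of_lt_of_le (by positivity) hN
  rw [div_le_iff₀ hy] at hN
  have hround : ∀ t ∈ Finset.range T,
      N * ENNReal.ofReal (m ^ 2 / (2048 * κ) * (η / (√T + σS ^ 2 * t))) ≤
      4 * ∑ j ∈ Finset.range N,
        (hardMarket α₀ α₁ κ m s ν σS (1 + D * j / N)).roundRegret ρ π t := by
    intro t ht
    have htT := Finset.mem_range.1 ht
    refine mul_le_sum_roundRegret_hardMarket hκ hs hm hD hD1 hη hηD hηs ρ π htT hR hRT hreg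
      (hN.trans ?_)
    gcongr
  have h1 := Finset.sum_le_sum hround
  rw [← Finset.mul_sum, ← Finset.mul_sum, Finset.sum_comm] at h1
  have h2 : ∑ j ∈ Finset.range N, ∑ t ∈ Finset.range T,
      (hardMarket α₀ α₁ κ m s ν σS (1 + D * j / N)).roundRegret ρ π t ≤
      N * ENNReal.ofReal R := by
    calc _ ≤ ∑ j ∈ Finset.range N, ENNReal.ofReal R := by
          refine Finset.sum_le_sum fun j hj => hreg _ ?_ ?_
          · have : 0 ≤ D * j / N := by positivity
            linarith
          · have h3 : (j : ℝ) ≤ N := by exact_mod_cast (Finset.mem_range.1 hj).le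
            have h4 : D * j / N ≤ D := by
              rw [div_le_iff₀ hNpos]
              gcongr
            linarith
      _ = N * ENNReal.ofReal R := by simp
  have h3 := h1.trans (mul_le_mul_right h2 4)
  rw [← ENNReal.ofReal_sum_of_nonneg (fun t _ => by positivity), ← ENNReal.ofReal_natCast N,
    show (4 : ℝ≥0∞) = ENNReal.ofReal 4 by simp, ← ENNReal.ofReal_mul (by positivity),
    ← ENNReal.ofReal_mul (by positivity), ← ENNReal.ofReal_mul (by positivity),
    ENNReal.ofReal_le_ofReal_iff (by positivity), ← Finset.mul_sum] at h3
  have h4 : m ^ 2 / (2048 * κ) * ∑ t ∈ Finset.range T, η / (√T + σS ^ 2 * t) ≤ 4 * R := by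
    refine le_of_mul_le_mul_left ?_ hNpos
    linarith
  have h5 : ∑ t ∈ Finset.range T, η / (√T + σS ^ 2 * t) =
      η * ∑ t ∈ Finset.range T, 1 / (√T + σS ^ 2 * t) := by
    rw [Finset.mul_sum]
    exact Finset.sum_congr rfl fun t _ => by rw [mul_one_div]
  rw [h5] at h4
  have h6 := log_one_add_div_le_sum (v := σS ^ 2) (by positivity) hT
  calc m ^ 2 * η / (8192 * κ) * (Real.log (1 + σS ^ 2 * √T) / σS ^ 2)
      ≤ m ^ 2 * η / (8192 * κ) * ∑ t ∈ Finset.range T, 1 / (√T + σS ^ 2 * t) := by gcongr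
    _ = (m ^ 2 / (2048 * κ) * (η * ∑ t ∈ Finset.range T, 1 / (√T + σS ^ 2 * t))) / 4 := by
        field_simp
        ring
    _ ≤ R := by linarith

end Market

/-! ### Admissible parameters and conclusion -/

/-- At `τ = 1` the family sits at the corner `(bHi, βLo, sHi)`. As `τ` grows it moves towards the
opposite endpoints, which by continuity are not passed for `τ` near `1`. -/
theorem exists_pos_forall_Icc_hardMarket_parameters {α₀ α₁ bLo bHi βLo βHi sLo sHi : ℝ}
    (hb : bLo < bHi) (hβ : βLo < βHi) (hs : sLo < sHi) :
    ∃ D : ℝ, 0 < D ∧ D ≤ 1 ∧ ∀ τ, 1 ≤ τ → τ ≤ 1 + D →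
      bLo ≤ α₀ + (bHi - α₀) / τ ∧ α₁ - (α₁ - βLo) / τ ^ 2 ≤ βHi ∧ sLo ≤ sHi / τ ^ 2 := by
  have h1 : ContinuousAt (fun τ : ℝ => α₀ + (bHi - α₀) / τ) 1 := by fun_prop (disch := norm_num)
  have h2 : ContinuousAt (fun τ : ℝ => α₁ - (α₁ - βLo) / τ ^ 2) 1 := by
    fun_prop (disch := norm_num)
  have h3 : ContinuousAt (fun τ : ℝ => sHi / τ ^ 2) 1 := by fun_prop (disch := norm_num)
  have e1 := h1.eventually (lt_mem_nhds (a := bLo) (by simpa using hb))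
  have e2 := h2.eventually (gt_mem_nhds (show _ < βHi by simpa using hβ))
  have e3 := h3.eventually (lt_mem_nhds (a := sLo) (by simpa using hs))
  obtain ⟨ε, hε, hball⟩ := Metric.eventually_nhds_iff.1 (e1.and (e2.and e3))
  refine ⟨min 1 (ε / 2), by positivity, min_le_left _ _, fun τ hτ hτD => ?_⟩
  have hd : dist τ 1 < ε := by
    rw [Real.dist_eq, abs_of_nonneg (by linarith)]
    linarith [min_le_right 1 (ε / 2)]
  obtain ⟨g1, g2, g3⟩ := hball hd
  exact ⟨g1.le, g2.le, g3.le⟩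

theorem theorem5
    (α₀ α₁ : ℝ) (hα₁ : 0 ≤ α₁)
    (bLo bHi : ℝ) (hb : bLo < bHi) (hbα : α₀ < bHi)
    (βLo βHi : ℝ) (hβ : βLo < βHi) (hβ0 : βHi < 0)
    (sLo sHi : ℝ) (hs0 : 0 < sLo) (hs : sLo < sHi) :
    ∃ c : ℝ, 0 < c ∧
      ∀ (T : ℕ), 1 ≤ T → ∀ (σS : ℝ), 0 < σS →
      ∀ (d : ℕ) (ν : Measure (Fin d → ℝ)) [IsProbabilityMeasure ν]
        (F : Set ((Fin d → ℝ) → ℝ)), (∀ b ∈ Set.Icc bLo bHi, (fun _ => b) ∈ F) →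
      ∀ (S : Type*) [MeasurableSpace S] (ρ : Measure S) [IsProbabilityMeasure ρ]
        (π : PricingPolicy S d),
      ∃ f ∈ F, ∃ β ∈ Set.Icc βLo βHi, ∃ σD ∈ Set.Icc sLo sHi,
        ENNReal.ofReal (c * min (Real.sqrt T)
            (Real.log T / (σS ^ 2 * (1 + max 0 (Real.log (1 / σS))))))
          ≤ Market.regret
              { α₀ := α₀, α₁ := α₁, β := β, f := f, ν := ν, σS := σS, σD := σD } ρ π T := by
  obtain ⟨D, hD, hD1, hpar⟩ := exists_pos_forall_Icc_hardMarket_parameters (α₀ := α₀) (α₁ := α₁)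
    hb hβ hs
  set κ := α₁ - βLo with hκdef
  set m := bHi - α₀ with hmdef
  have hκ : 0 < κ := by linarith
  have hm : 0 < m := by linarith
  have hsHi : 0 < sHi := by linarith
  set η := min (D ^ 2 / 4) (2 * sHi ^ 2 / (96 * κ + 96 + 2 * m ^ 2)) with hηdef
  have hη : 0 < η := by positivity
  have hηD : η ≤ D ^ 2 / 4 := min_le_left _ _
  have hηs : η * (96 * κ + 96 + 2 * m ^ 2) ≤ 2 * sHi ^ 2 := by
    rw [← le_div_iff₀ (by positivity)]
    exact min_le_right _ _
  set C := m ^ 2 * η / (8192 * κ) with hC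
  have hC0 : 0 < C := by positivity
  -- The `1` ensures `R ≤ √T`. The `32` is twice the `16` of `min_sqrt_log_le`, so that regrets
  -- below `R = c * B` would give `C * B ≤ 16 * R ≤ C * B / 2`.
  refine ⟨min 1 (C / 32), by positivity, fun T hT σS hσS d ν _ F hF S _ ρ _ π => ?_⟩
  set B := min (Real.sqrt T) (Real.log T / (σS ^ 2 * (1 + max 0 (Real.log (1 / σS))))) with hB
  have hB0 : 0 ≤ B := le_min (Real.sqrt_nonneg _)
    (div_nonneg (Real.log_nonneg (by exact_mod_cast hT)) (by positivity))
  have hmem : ∀ τ, 1 ≤ τ → τ ≤ 1 + D → (fun _ => α₀ + m / τ) ∈ F ∧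
      α₁ - κ / τ ^ 2 ∈ Set.Icc βLo βHi ∧ sHi / τ ^ 2 ∈ Set.Icc sLo sHi := by
    intro τ hτ hτD
    obtain ⟨g1, g2, g3⟩ := hpar τ hτ hτD
    have hτ2 : 1 ≤ τ ^ 2 := one_le_pow₀ hτ
    have k1 : m / τ ≤ m := div_le_self hm.le hτ
    have k2 : κ / τ ^ 2 ≤ κ := div_le_self hκ.le hτ2
    exact ⟨hF _ ⟨g1, by linarith⟩, ⟨by linarith, g2⟩, g3, div_le_self hsHi.le hτ2⟩
  by_contra hcon
  have hlt : ∀ τ, 1 ≤ τ → τ ≤ 1 + D → (Market.hardMarket α₀ α₁ κ m sHi ν σS τ).regret ρ π T <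
      ENNReal.ofReal (min 1 (C / 32) * B) := by
    intro τ hτ hτD
    obtain ⟨g1, g2, g3⟩ := hmem τ hτ hτD
    by_contra hge
    exact hcon ⟨_, g1, _, g2, _, g3, not_lt.1 hge⟩
  -- The strict inequality in the negated claim rules out a vanishing bound, as occurs for `T = 1`.
  have hpos : 0 < min 1 (C / 32) * B :=
    ENNReal.ofReal_pos.1 (lt_of_le_of_lt zero_le (hlt 1 le_rfl (by linarith)))
  have hRT : min 1 (C / 32) * B ≤ √T :=
    (mul_le_of_le_one_left hB0 (min_le_left _ _)).trans (min_le_left _ _)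
  have h1 := Market.log_le_of_regret_hardMarket_le hκ hsHi hm hD hD1 hη hηD hηs hσS ρ π hT
    hpos.le hRT fun τ hτ hτD => (hlt τ hτ hτD).le
  have h2 := min_sqrt_log_le hσS hT
  rw [← hC] at h1
  have h3 : min 1 (C / 32) * B ≤ C / 32 * B :=
    mul_le_mul_of_nonneg_right (min_le_right _ _) hB0
  have h4 : C * B ≤ C * (16 * (Real.log (1 + σS ^ 2 * √T) / σS ^ 2)) :=
    mul_le_mul_of_nonneg_left h2 hC0.le
  linarith

end
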